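/- A weighted graph $G_w$ is a finite simple graph $G$ together with a positive real weight on each edge; its adjacency matrix has the weight of $xy$ in position $(x,y)$ if $xy$ is an edge and $0$ otherwise, and $i_+(G_w)$ is the number of positive eigenvalues of this matrix, counted with multiplicity. A bicyclic graph is a connected simple graph with exactly one more edge than vertices. A pendant is a vertex of degree one, and pendant twins are two distinct pendants with the same neighbourhood. Let $\theta(p,l,q)$ be the graph formed by two vertices $u,v$ and three internally disjoint paths from $u$ to $v$ with $p$, $l$, $q$ inner vertices, whose edge weights, in order from $u$ to $v$, are $a_1,\dots,a_{p+1}$; $b_1,\dots,b_{l+1}$; $c_1,\dots,c_{q+1}$ respectively. "Attaching a path" to a vertex means joining that vertex by an edge to one end of a new path. Define - $G^1,G^2$: $\theta(1,1,1)$ with one pendant attached, at $u$ for $G^1$, at the inner vertex of the $c$-path for $G^2$; - $G^3$: $\theta(1,1,1)$ with one pendant attached at $u$ and one at $v$; - $G^4,G^5$: $\theta(1,1,1)$ with a path on two vertices attached, at $u$ for $G^4$, at the inner vertex of the $c$-path for $G^5$; - $G^6,G^7$: $\theta(1,0,1)$ with one pendant attached, at $u$ for $G^6$, at the inner vertex of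 the $c$-path for $G^7$; - $G^8$: $\theta(1,0,1)$ with one pendant attached at $u$ and one at $v$; - $G^9,G^{10}$: $\theta(1,0,1)$ with a path on two vertices attached, at $u$ for $G^9$, at the inner vertex of the $c$-path for $G^{10}$; - $G^{11}$: $\theta(2,0,1)$ with one pendant attached at the inner vertex of the $c$-path. **Theorem.** (i) Let $G_w$ be a weighted bicyclic graph that has a pendant but no pendant twins. Then $i_+(G_w)=2$ if and only if $G$ is isomorphic to one of $G^1,\dots,G^{11}$ in such a way that the weights, transported by the isomorphism, satisfy the following condition: - $G^1,G^3,G^6,G^7,G^8$: no condition; - $G^2$: $a_1b_2=a_2b_1$; - $G^4,G^5$: $a_1b_2=a_2b_1$ and $a_1c_2=a_2c_1$; - $G^9,G^{10}$: $a_1c_2=a_2c_1$; - $G^{11}$: $a_1a_3=a_2b_1$. (ii) For every choice of positive weights, $i_+(G_w)\ge 3$ if $G$ is isomorphic to one of the following 25 graphs $G^{12},\dots,G^{36}$. Here $x$ denotes an inner vertex of one of the three paths. - $\theta(1,1,1)$ with two pendants, attached at $u$ and $x$, or at two different inner vertices (2 graphs); - $\theta(1,1,1)$ with a path on two vertices attached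 at a vertex $s$ and a pendant attached at a vertex $t$, where $(s,t)$ is $(u,u)$, $(u,v)$, $(u,x)$, $(x,u)$, $(x',x)$ with $x'\neq x$ another inner vertex, or $(x,x)$ (6 graphs); - $\theta(1,0,1)$ with two pendants, attached at $u$ and $x$, or at the two inner vertices (2 graphs); - $\theta(1,0,1)$ with a path on two vertices attached at $s$ and a pendant attached at $t$, with the same six possibilities for $(s,t)$ (6 graphs); - $\theta(1,0,1)$ with a path on three vertices attached by one of its ends, at $u$ or at $x$ (2 graphs); - $\theta(2,0,1)$ with a pendant attached at $u$ or at an inner vertex of the $a$-path (2 graphs); - $\theta(2,0,1)$ with a path on two vertices attached at $u$, at an inner vertex of the $a$-path, or at the inner vertex of the $c$-path (3 graphs); - $\theta(2,0,2)$ with a pendant attached at $u$ or at an inner vertex (2 graphs). -/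

import Mathlib

namespace InertiaBicyclic

/-- A simple graph on the vertex set `V` with a positive real weight on every edge
(the values of `weight` outside the edge set are never used). -/
structure WeightedGraph (V : Type*) where
  graph : SimpleGraph V
  weight : Sym2 V → ℝ
  weight_pos : ∀ e ∈ graph.edgeSet, 0 < weight e

namespace WeightedGraph

variable {V : Type*}

open Classical in
/-- The weighted adjacency matrix: the entry at `(x, y)` is the weight of the edge `xy`,
and `0` if `x` and `y` are not adjacent. -/
noncomputable def adjMatrix (G : WeightedGraph V) : Matrix V V ℝ :=
  Matrix.of fun x y => if G.graph.Adj x y then G.weight s(x, y) else 0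

theorem adjMatrix_isHermitian (G : WeightedGraph V) : G.adjMatrix.IsHermitian := by
  ext x y
  by_cases h : G.graph.Adj x y
  · simp [adjMatrix, h, h.symm, Sym2.eq_swap]
  · have h' : ¬ G.graph.Adj y x := fun k => h k.symm
    simp [adjMatrix, h, h']

open Classical in
/-- The positive index of inertia: the number of positive eigenvalues of the weighted
adjacency matrix, counted with multiplicity. -/
noncomputable def posIndex [Fintype V] (G : WeightedGraph V) : ℕ :=
  Fintype.card {i : V // 0 < G.adjMatrix_isHermitian.eigenvalues i}

/-- Weight of the edge joining the images of the vertices `i` and `j` of a labelled graph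
under an identification `φ` of that graph with the underlying graph of `G`. -/
def labelWeight (G : WeightedGraph V) {n : ℕ} {H : SimpleGraph (Fin n)}
    (φ : H ≃g G.graph) (i j : Fin n) : ℝ :=
  G.weight s(φ i, φ j)

end WeightedGraph

/-- Connected, with one more edge than vertices. -/
def IsBicyclic {V : Type*} [Fintype V] (G : SimpleGraph V) : Prop :=
  G.Connected ∧ G.edgeSet.ncard = Fintype.card V + 1

/-- A vertex of degree one. -/
def IsPendant {V : Type*} (G : SimpleGraph V) (v : V) : Prop :=
  (G.neighborSet v).ncard = 1

/-- Two distinct pendant vertices with the same neighbourhood. -/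
def IsPendantTwin {V : Type*} (G : SimpleGraph V) (u v : V) : Prop :=
  u ≠ v ∧ IsPendant G u ∧ IsPendant G v ∧ G.neighborSet u = G.neighborSet v

/-- The simple graph on the vertices `0, …, n - 1` with the listed edges. -/
def graphOn (n : ℕ) (edges : List (ℕ × ℕ)) : SimpleGraph (Fin n) :=
  SimpleGraph.fromRel fun i j => (i.val, j.val) ∈ edges

/-!
The four bases. The vertices `0` and `1` are the two vertices of degree three, and each base
consists of three internally disjoint paths from `0` to `1`, listed in the order
`a₁, a₂, …`; `b₁, b₂, …`; `c₁, c₂, …` of their edges.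
-/

/-- `θ(1,1,1)`: paths `0-2-1`, `0-3-1`, `0-4-1`. -/
def theta111 : List (ℕ × ℕ) := [(0, 2), (2, 1), (0, 3), (3, 1), (0, 4), (4, 1)]

/-- `θ(1,0,1)`: paths `0-2-1`, `0-1`, `0-3-1`. -/
def theta101 : List (ℕ × ℕ) := [(0, 2), (2, 1), (0, 1), (0, 3), (3, 1)]

/-- `θ(2,0,1)`, isomorphic to `θ(1,0,2)`: paths `0-2-3-1`, `0-1`, `0-4-1`. -/
def theta201 : List (ℕ × ℕ) := [(0, 2), (2, 3), (3, 1), (0, 1), (0, 4), (4, 1)]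

/-- `θ(2,0,2)`: paths `0-2-3-1`, `0-1`, `0-4-5-1`. -/
def theta202 : List (ℕ × ℕ) := [(0, 2), (2, 3), (3, 1), (0, 1), (0, 4), (4, 5), (5, 1)]

/-! The eleven underlying graphs: a base with pendant vertices or a pendant path attached. -/

/-- `θ(1,1,1)` with a pendant at a vertex of degree three. -/
def graph1 : SimpleGraph (Fin 6) := graphOn 6 (theta111 ++ [(0, 5)])

/-- `θ(1,1,1)` with a pendant at a vertex of degree two (the one on the `c`-path). -/
def graph2 : SimpleGraph (Fin 6) := graphOn 6 (theta111 ++ [(4, 5)])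

/-- `θ(1,1,1)` with one pendant at each of the vertices of degree three. -/
def graph3 : SimpleGraph (Fin 7) := graphOn 7 (theta111 ++ [(0, 5), (1, 6)])

/-- `θ(1,1,1)` with a path on two vertices attached at a vertex of degree three. -/
def graph4 : SimpleGraph (Fin 7) := graphOn 7 (theta111 ++ [(0, 5), (5, 6)])

/-- `θ(1,1,1)` with a path on two vertices attached at a vertex of degree two. -/
def graph5 : SimpleGraph (Fin 7) := graphOn 7 (theta111 ++ [(4, 5), (5, 6)])

/-- `θ(1,0,1)` with a pendant at a vertex of degree three. -/
def graph6 : SimpleGraph (Fin 5) := graphOn 5 (theta101 ++ [(0, 4)])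

/-- `θ(1,0,1)` with a pendant at a vertex of degree two. -/
def graph7 : SimpleGraph (Fin 5) := graphOn 5 (theta101 ++ [(3, 4)])

/-- `θ(1,0,1)` with one pendant at each of the vertices of degree three. -/
def graph8 : SimpleGraph (Fin 6) := graphOn 6 (theta101 ++ [(0, 4), (1, 5)])

/-- `θ(1,0,1)` with a path on two vertices attached at a vertex of degree three. -/
def graph9 : SimpleGraph (Fin 6) := graphOn 6 (theta101 ++ [(0, 4), (4, 5)])

/-- `θ(1,0,1)` with a path on two vertices attached at a vertex of degree two. -/
def graph10 : SimpleGraph (Fin 6) := graphOn 6 (theta101 ++ [(3, 4), (4, 5)])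

/-- `θ(2,0,1)` with a pendant at the inner vertex of the path with one inner vertex. -/
def graph11 : SimpleGraph (Fin 6) := graphOn 6 (theta201 ++ [(4, 5)])

namespace WeightedGraph

variable {V : Type*}

/-! `G.IsType i`: the weighted graph `G` is one of the graphs with underlying graph `graph i`
whose weights satisfy the weight condition that belongs to `graph i`. -/

def IsType1 (G : WeightedGraph V) : Prop := Nonempty (graph1 ≃g G.graph)

/-- Condition `a₁ b₂ = a₂ b₁`. -/
def IsType2 (G : WeightedGraph V) : Prop :=
  ∃ φ : graph2 ≃g G.graph,
    G.labelWeight φ 0 2 * G.labelWeight φ 3 1 = G.labelWeight φ 2 1 * G.labelWeight φ 0 3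

def IsType3 (G : WeightedGraph V) : Prop := Nonempty (graph3 ≃g G.graph)

/-- Conditions `a₁ b₂ = a₂ b₁` and `a₁ c₂ = a₂ c₁`. -/
def IsType4 (G : WeightedGraph V) : Prop :=
  ∃ φ : graph4 ≃g G.graph,
    G.labelWeight φ 0 2 * G.labelWeight φ 3 1 = G.labelWeight φ 2 1 * G.labelWeight φ 0 3 ∧
    G.labelWeight φ 0 2 * G.labelWeight φ 4 1 = G.labelWeight φ 2 1 * G.labelWeight φ 0 4

/-- Conditions `a₁ b₂ = a₂ b₁` and `a₁ c₂ = a₂ c₁`. -/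
def IsType5 (G : WeightedGraph V) : Prop :=
  ∃ φ : graph5 ≃g G.graph,
    G.labelWeight φ 0 2 * G.labelWeight φ 3 1 = G.labelWeight φ 2 1 * G.labelWeight φ 0 3 ∧
    G.labelWeight φ 0 2 * G.labelWeight φ 4 1 = G.labelWeight φ 2 1 * G.labelWeight φ 0 4

def IsType6 (G : WeightedGraph V) : Prop := Nonempty (graph6 ≃g G.graph)

def IsType7 (G : WeightedGraph V) : Prop := Nonempty (graph7 ≃g G.graph)

def IsType8 (G : WeightedGraph V) : Prop := Nonempty (graph8 ≃g G.graph)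

/-- Condition `a₁ c₂ = a₂ c₁`. -/
def IsType9 (G : WeightedGraph V) : Prop :=
  ∃ φ : graph9 ≃g G.graph,
    G.labelWeight φ 0 2 * G.labelWeight φ 3 1 = G.labelWeight φ 2 1 * G.labelWeight φ 0 3

/-- Condition `a₁ c₂ = a₂ c₁`. -/
def IsType10 (G : WeightedGraph V) : Prop :=
  ∃ φ : graph10 ≃g G.graph,
    G.labelWeight φ 0 2 * G.labelWeight φ 3 1 = G.labelWeight φ 2 1 * G.labelWeight φ 0 3

/-- Condition `a₁ a₃ = a₂ b₁`. -/
def IsType11 (G : WeightedGraph V) : Prop :=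
  ∃ φ : graph11 ≃g G.graph,
    G.labelWeight φ 0 2 * G.labelWeight φ 3 1 = G.labelWeight φ 2 3 * G.labelWeight φ 0 1

end WeightedGraph

/-- The twenty-five further underlying graphs, each given by its number of vertices and its
list of edges. -/
def furtherGraphs : List (ℕ × List (ℕ × ℕ)) := [
  -- `θ(1,1,1)` with two pendants
  (7, theta111 ++ [(0, 5), (4, 6)]),
  (7, theta111 ++ [(3, 5), (4, 6)]),
  -- `θ(1,1,1)` with a path on two vertices and a pendant attached
  (8, theta111 ++ [(0, 5), (5, 6), (0, 7)]),
  (8, theta111 ++ [(0, 5), (5, 6), (1, 7)]),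
  (8, theta111 ++ [(0, 5), (5, 6), (4, 7)]),
  (8, theta111 ++ [(4, 5), (5, 6), (0, 7)]),
  (8, theta111 ++ [(4, 5), (5, 6), (3, 7)]),
  (8, theta111 ++ [(4, 5), (5, 6), (4, 7)]),
  -- `θ(1,0,1)` with two pendants
  (6, theta101 ++ [(0, 4), (3, 5)]),
  (6, theta101 ++ [(2, 4), (3, 5)]),
  -- `θ(1,0,1)` with a path on two vertices and a pendant attached
  (7, theta101 ++ [(0, 4), (4, 5), (0, 6)]),
  (7, theta101 ++ [(0, 4), (4, 5), (1, 6)]),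
  (7, theta101 ++ [(0, 4), (4, 5), (3, 6)]),
  (7, theta101 ++ [(3, 4), (4, 5), (0, 6)]),
  (7, theta101 ++ [(3, 4), (4, 5), (2, 6)]),
  (7, theta101 ++ [(3, 4), (4, 5), (3, 6)]),
  -- `θ(1,0,1)` with a path on three vertices attached by one of its ends
  (7, theta101 ++ [(0, 4), (4, 5), (5, 6)]),
  (7, theta101 ++ [(3, 4), (4, 5), (5, 6)]),
  -- `θ(2,0,1)` with a pendant
  (6, theta201 ++ [(0, 5)]),
  (6, theta201 ++ [(2, 5)]),
  -- `θ(2,0,1)` with a path on two vertices attached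
  (7, theta201 ++ [(0, 5), (5, 6)]),
  (7, theta201 ++ [(2, 5), (5, 6)]),
  (7, theta201 ++ [(4, 5), (5, 6)]),
  -- `θ(2,0,2)` with a pendant
  (7, theta202 ++ [(0, 6)]),
  (7, theta202 ++ [(2, 6)])]

end InertiaBicyclic

/-! Lower bounds on `posIndex` come from one principle: if `k` independent vertices are joined to
`k` vertices by a nonsingular block of the adjacency matrix, there are at least `k` positive
eigenvalues (`le_posIndex_of_det_ne_zero`). With a triangular 3 × 3 block it becomes a condition on
the graph alone (`three_le_posIndex`), and a finite search finds such a block in each of the 25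
further graphs. Upper bounds come from a subspace of codimension at most two on which the quadratic
form is nonpositive (`posIndex_le_of_nonpos`).

For the classification, let `v` be a pendant with neighbour `u`, delete both, and suppose the index
is two. No remaining vertex is isolated, since it would be a pendant twin of `v`. If some vertex
were nonadjacent to both ends of a remaining edge, then `vu`, that edge and an edge at the vertex
would force index three. So nonadjacency is transitive and the rest is complete multipartite. Being
bicyclic rules out a fourth class and gives, for class sizes p, q, r and d neighbours of `u` other
than `v`, the equation d + pq + pr + qr = p + q + r + 2. Without pendant twins it has finitely many
solutions up to reordering the classes, and each of them is one of the eleven graphs.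

The weight conditions say that the 2 × 2 minors of the rest with independent rows vanish.
Conversely, they make its quadratic form a product of two linear forms, up to a positive factor and
possibly minus a square; killing one factor and the coordinate of `u` gives the upper bound. -/

namespace InertiaBicyclic

namespace WeightedGraph

open Matrix

/-! ### Bounds on the positive index of inertia -/

section Inertia

variable {V : Type*} (G : WeightedGraph V)

theorem adjMatrix_apply_of_adj {x y : V} (h : G.graph.Adj x y) :
    G.adjMatrix x y = G.weight s(x, y) := by
  simp [adjMatrix, h]

theorem adjMatrix_apply_of_not_adj {x y : V} (h : ¬ G.graph.Adj x y) : G.adjMatrix x y = 0 := by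
  simp [adjMatrix, h]

theorem adjMatrix_pos {x y : V} (h : G.graph.Adj x y) : 0 < G.adjMatrix x y := by
  rw [adjMatrix_apply_of_adj G h]
  exact G.weight_pos _ h

variable [Fintype V]

open Classical in
/-- The spectral theorem as a diagonalization of the quadratic form of the adjacency matrix. -/
theorem exists_orthogonal_diagonalization : ∃ U : Matrix V V ℝ, Uᵀ * U = 1 ∧
    ∀ x : V → ℝ, x ⬝ᵥ G.adjMatrix *ᵥ x =
      ∑ i, G.adjMatrix_isHermitian.eigenvalues i * (Uᵀ *ᵥ x) i ^ 2 := by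
  set hA := G.adjMatrix_isHermitian
  refine ⟨hA.eigenvectorUnitary, ?_, fun x => ?_⟩
  · have := Unitary.coe_star_mul_self hA.eigenvectorUnitary
    rwa [star_eq_conjTranspose, conjTranspose_eq_transpose_of_trivial] at this
  · have h := hA.spectral_theorem
    rw [Unitary.conjStarAlgAut_apply, star_eq_conjTranspose,
      conjTranspose_eq_transpose_of_trivial] at h
    conv_lhs => rw [h]
    rw [← mulVec_mulVec, ← mulVec_mulVec, dotProduct_mulVec, ← mulVec_transpose]
    simp only [dotProduct, mulVec_diagonal, Function.comp_apply, RCLike.ofReal_real_eq_id, id]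
    exact Finset.sum_congr rfl fun i _ => by ring

/-- If there were more than `m` positive eigenvalues, a dimension count would give a nonzero
combination of their eigenvectors in the kernel of `l`, where the form would be both positive and
nonpositive. -/
theorem posIndex_le_of_nonpos {m : ℕ} (l : (V → ℝ) →ₗ[ℝ] (Fin m → ℝ))
    (h : ∀ x, l x = 0 → x ⬝ᵥ G.adjMatrix *ᵥ x ≤ 0) : G.posIndex ≤ m := by
  classical
  obtain ⟨U, hU, hQ⟩ := G.exists_orthogonal_diagonalization
  by_contra! hlt
  let P := {i : V // 0 < G.adjMatrix_isHermitian.eigenvalues i}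
  let ext : (P → ℝ) →ₗ[ℝ] (V → ℝ) := Function.ExtendByZero.linearMap ℝ (Subtype.val : P → V)
  have hext : ∀ (c : P → ℝ) (i : P), ext c i = c i := fun c i =>
    (Subtype.val_injective (p := fun i => 0 < G.adjMatrix_isHermitian.eigenvalues i)).extend_apply
      c 0 i
  have hext' : ∀ (c : P → ℝ) (i : V), ¬ 0 < G.adjMatrix_isHermitian.eigenvalues i →
      ext c i = 0 := fun c i hi =>
    Function.extend_apply' (f := (Subtype.val : P → V)) c 0 i (by rintro ⟨a, rfl⟩; exact hi a.2)
  let F : (P → ℝ) →ₗ[ℝ] (Fin m → ℝ) := l ∘ₗ U.mulVecLin ∘ₗ ext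
  have hF : LinearMap.ker F ≠ ⊥ := LinearMap.ker_ne_bot_of_finrank_lt (by
    have hP : Fintype.card P = G.posIndex := Fintype.card_congr (Equiv.refl _)
    simpa only [Module.finrank_fintype_fun_eq_card, Fintype.card_fin, hP] using hlt)
  obtain ⟨c, hc, hc0⟩ := (Submodule.ne_bot_iff _).1 hF
  have hle := h (U *ᵥ ext c) hc
  rw [hQ, mulVec_mulVec, hU, one_mulVec] at hle
  have hnn : ∀ i, 0 ≤ G.adjMatrix_isHermitian.eigenvalues i * ext c i ^ 2 := fun i => by
    by_cases hi : 0 < G.adjMatrix_isHermitian.eigenvalues i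
    · positivity
    · simp [hext' c i hi]
  have hz := (Finset.sum_eq_zero_iff_of_nonneg fun i _ => hnn i).1
    (le_antisymm hle (Finset.sum_nonneg fun i _ => hnn i))
  refine hc0 (funext fun i => ?_)
  have := hz i (Finset.mem_univ _)
  rw [hext] at this
  simpa [i.2.ne'] using this

/-- The columns of `X` span a `k`-dimensional space on which the form is positive definite. Were `k`
larger than the index, some nonzero vector of it would be orthogonal to all eigenvectors with
positive eigenvalue, and the form would be nonpositive there. -/
theorem le_posIndex_of_transpose_mul_mul_eq_one {k : ℕ} (X : Matrix V (Fin k) ℝ)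
    (h : Xᵀ * G.adjMatrix * X = 1) : k ≤ G.posIndex := by
  classical
  obtain ⟨U, -, hQ⟩ := G.exists_orthogonal_diagonalization
  by_contra! hlt
  let P := {i : V // 0 < G.adjMatrix_isHermitian.eigenvalues i}
  let F : (Fin k → ℝ) →ₗ[ℝ] (P → ℝ) :=
    LinearMap.funLeft ℝ ℝ Subtype.val ∘ₗ Uᵀ.mulVecLin ∘ₗ X.mulVecLin
  have hF : LinearMap.ker F ≠ ⊥ := LinearMap.ker_ne_bot_of_finrank_lt (by
    have hP : Fintype.card P = G.posIndex := Fintype.card_congr (Equiv.refl _)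
    simpa only [Module.finrank_fintype_fun_eq_card, Fintype.card_fin, hP] using hlt)
  obtain ⟨c, hc, hc0⟩ := (Submodule.ne_bot_iff _).1 hF
  have hcc : c ⬝ᵥ c = X *ᵥ c ⬝ᵥ G.adjMatrix *ᵥ (X *ᵥ c) := by
    conv_lhs => rhs; rw [← one_mulVec c, ← h, ← mulVec_mulVec, ← mulVec_mulVec]
    rw [dotProduct_mulVec, vecMul_transpose]
  refine hc0 (dotProduct_self_eq_zero.1 (le_antisymm ?_ ?_))
  · rw [hcc, hQ]
    refine Finset.sum_nonpos fun i _ => ?_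
    by_cases hi : 0 < G.adjMatrix_isHermitian.eigenvalues i
    · have : (Uᵀ *ᵥ (X *ᵥ c)) i = 0 := congrFun hc ⟨i, hi⟩
      simp [this]
    · exact mul_nonpos_of_nonpos_of_nonneg (not_lt.1 hi) (sq_nonneg _)
  · exact Finset.sum_nonneg fun i _ => mul_self_nonneg _

/-- An independent set of `k` vertices that is nonsingularly joined to `k` further vertices
contributes `k` positive eigenvalues. -/
theorem le_posIndex_of_det_ne_zero {k : ℕ} (p q : Fin k → V)
    (hp : ∀ i j, i < j → ¬ G.graph.Adj (p i) (p j)) (h : (G.adjMatrix.submatrix p q).det ≠ 0) :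
    k ≤ G.posIndex := by
  classical
  set A := G.adjMatrix
  have hA : Aᵀ = A := G.adjMatrix_isHermitian
  let P : Matrix V (Fin k) ℝ := (1 : Matrix V V ℝ).submatrix id p
  let R : Matrix V (Fin k) ℝ := (1 : Matrix V V ℝ).submatrix id q
  have key : ∀ f g : Fin k → V, ((1 : Matrix V V ℝ).submatrix id f)ᵀ * A *
      (1 : Matrix V V ℝ).submatrix id g = A.submatrix f g := fun f g => by
    ext i j
    simp [Matrix.mul_apply, Matrix.one_apply]
  set M := A.submatrix p q with hM
  set N := A.submatrix q q with hN
  have hPP : Pᵀ * A * P = 0 := by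
    rw [key]; ext i j; refine G.adjMatrix_apply_of_not_adj ?_
    rcases lt_trichotomy i j with h | rfl | h
    · exact hp i j h
    · exact G.graph.loopless.irrefl _
    · exact fun k => hp j i h k.symm
  have hPR : Pᵀ * A * R = M := key p q
  have hRR : Rᵀ * A * R = N := key q q
  have hNt : Nᵀ = N := by rw [hN, transpose_submatrix, hA]
  have hRP : Rᵀ * A * P = Mᵀ := by rw [key, hM, transpose_submatrix, hA]
  have hMM : M⁻¹ * M = 1 := nonsing_inv_mul _ (isUnit_iff_ne_zero.2 h)
  -- On the columns of `P` and `R` the form has blocks 0, `M`, `Mᵀ`, `N`. The Gram matrix of `P * Sᵀ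
  -- + R` is `S * M + (S * M)ᵀ + N`, so `S` is chosen with `S * M` equal to half of `1 - N`, which
  -- is symmetric.
  let S : Matrix (Fin k) (Fin k) ℝ := (1 / 2 : ℝ) • ((1 - N) * M⁻¹)
  have hSM : S * M = (1 / 2 : ℝ) • (1 - N) := by
    rw [smul_mul_assoc, Matrix.mul_assoc, hMM, Matrix.mul_one]
  have hMS : Mᵀ * Sᵀ = (1 / 2 : ℝ) • (1 - N) := by
    rw [← transpose_mul, hSM, transpose_smul, transpose_sub, hNt, transpose_one]
  refine G.le_posIndex_of_transpose_mul_mul_eq_one (P * Sᵀ + R) ?_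
  calc (P * Sᵀ + R)ᵀ * A * (P * Sᵀ + R)
      = S * (Pᵀ * A * P) * Sᵀ + S * (Pᵀ * A * R) + (Rᵀ * A * P) * Sᵀ + Rᵀ * A * R := by
        simp only [transpose_add, transpose_mul, transpose_transpose, Matrix.add_mul,
          Matrix.mul_add, Matrix.mul_assoc]
        abel
    _ = 1 := by
        rw [hPP, hPR, hRP, hRR, hSM, hMS]
        ext i j
        simp only [Matrix.add_apply, Matrix.smul_apply, Matrix.sub_apply, Matrix.mul_zero,
          Matrix.zero_mul, Matrix.zero_apply, smul_eq_mul]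
        ring

/-- If `a`, `c`, `e` are independent, `ab`, `cd`, `ef` are edges, and `a` is not joined to
`d`, `f`, nor `c` to `f`, then there are three positive eigenvalues. -/
theorem three_le_posIndex {a b c d e f : V} (hab : G.graph.Adj a b) (hcd : G.graph.Adj c d)
    (hef : G.graph.Adj e f) (hac : ¬ G.graph.Adj a c) (hae : ¬ G.graph.Adj a e)
    (hce : ¬ G.graph.Adj c e) (had : ¬ G.graph.Adj a d) (haf : ¬ G.graph.Adj a f)
    (hcf : ¬ G.graph.Adj c f) : 3 ≤ G.posIndex := by
  refine G.le_posIndex_of_det_ne_zero ![a, c, e] ![b, d, f] ?_ ?_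
  · intro i j
    fin_cases i <;> fin_cases j <;> simp [*]
  · have := G.adjMatrix_pos hab
    have := G.adjMatrix_pos hcd
    have := G.adjMatrix_pos hef
    -- The block is lower triangular with positive diagonal.
    rw [det_fin_three]
    simp only [submatrix_apply, cons_val, G.adjMatrix_apply_of_not_adj had,
      G.adjMatrix_apply_of_not_adj haf, G.adjMatrix_apply_of_not_adj hcf]
    ring_nf
    positivity

theorem two_le_posIndex {a b c d : V} (hab : G.graph.Adj a b) (hcd : G.graph.Adj c d)
    (hac : ¬ G.graph.Adj a c) (had : ¬ G.graph.Adj a d) : 2 ≤ G.posIndex := by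
  refine G.le_posIndex_of_det_ne_zero ![a, c] ![b, d] ?_ ?_
  · intro i j
    fin_cases i <;> fin_cases j <;> simp [*]
  · have := G.adjMatrix_pos hab
    have := G.adjMatrix_pos hcd
    rw [det_fin_two]
    simp only [submatrix_apply, cons_val_zero, cons_val_one, G.adjMatrix_apply_of_not_adj had]
    ring_nf
    positivity

/-- Deleting the pendant `a` and its neighbour `b` from a graph with two positive eigenvalues
leaves only singular `2 × 2` blocks whose rows are independent. -/
theorem adjMatrix_mul_eq_of_posIndex_eq_two {a b c c' d d' : V} (hG : G.posIndex = 2)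
    (hab : G.graph.Adj a b) (ha : ∀ x, G.graph.Adj a x → x = b) (hc : c ≠ b) (hc' : c' ≠ b)
    (hd : d ≠ b) (hd' : d' ≠ b) (hcc' : ¬ G.graph.Adj c c') :
    G.adjMatrix c d * G.adjMatrix c' d' = G.adjMatrix c d' * G.adjMatrix c' d := by
  by_contra hne
  have hac : ¬ G.graph.Adj a c := fun h => hc (ha _ h)
  have hac' : ¬ G.graph.Adj a c' := fun h => hc' (ha _ h)
  have had : ¬ G.graph.Adj a d := fun h => hd (ha _ h)
  have had' : ¬ G.graph.Adj a d' := fun h => hd' (ha _ h)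
  have : 3 ≤ G.posIndex := by
    refine G.le_posIndex_of_det_ne_zero ![a, c, c'] ![b, d, d'] ?_ ?_
    · intro i j
      fin_cases i <;> fin_cases j <;> simp [*]
    · have hpos := G.adjMatrix_pos hab
      rw [det_fin_three]
      simp only [submatrix_apply, cons_val, G.adjMatrix_apply_of_not_adj had,
        G.adjMatrix_apply_of_not_adj had']
      intro h0
      refine hne (mul_left_cancel₀ hpos.ne' ?_)
      -- The first row of the block vanishes off the entry `ab`, so the determinant is that entry
      -- times the 2 × 2 minor.
      linear_combination h0
  omega

end Inertia

end WeightedGraph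

/-! ### Transport to labelled graphs -/

theorem graphOn_adj {n : ℕ} {E : List (ℕ × ℕ)} {i j : Fin n} :
    (graphOn n E).Adj i j ↔ i ≠ j ∧ ((i.val, j.val) ∈ E ∨ (j.val, i.val) ∈ E) :=
  SimpleGraph.fromRel_adj _ _ _

instance (n : ℕ) (E : List (ℕ × ℕ)) : DecidableRel (graphOn n E).Adj := fun _ _ =>
  decidable_of_iff' _ graphOn_adj

namespace WeightedGraph

variable {V : Type*} [Fintype V] (G : WeightedGraph V) {n : ℕ} {H : SimpleGraph (Fin n)}
  (φ : H ≃g G.graph)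

section

omit [Fintype V]

theorem labelWeight_comm (i j : Fin n) : G.labelWeight φ i j = G.labelWeight φ j i := by
  rw [labelWeight, labelWeight, Sym2.eq_swap]

theorem labelWeight_pos {i j : Fin n} (h : H.Adj i j) : 0 < G.labelWeight φ i j :=
  G.weight_pos _ (φ.map_adj_iff.2 h)

theorem labelWeight_eq_adjMatrix {i j : Fin n} (h : H.Adj i j) :
    G.labelWeight φ i j = G.adjMatrix (φ i) (φ j) :=
  (G.adjMatrix_apply_of_adj (φ.map_adj_iff.2 h)).symm

end

/-- The quadratic form of the adjacency matrix in the coordinates of an identification of the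
underlying graph with a labelled graph. -/
theorem dotProduct_adjMatrix_mulVec [DecidableRel H.Adj] (x : V → ℝ) :
    x ⬝ᵥ G.adjMatrix.mulVec x = 2 * ∑ i, ∑ j, if i < j ∧ H.Adj i j then
      G.labelWeight φ i j * x (φ i) * x (φ j) else 0 := by
  let F : Fin n → Fin n → ℝ := fun i j => G.adjMatrix (φ i) (φ j) * x (φ i) * x (φ j)
  have hF : ∀ i j, F i j = (if i < j ∧ H.Adj i j then
      G.labelWeight φ i j * x (φ i) * x (φ j) else 0) + (if j < i ∧ H.Adj j i then
      G.labelWeight φ j i * x (φ j) * x (φ i) else 0) := fun i j => by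
    by_cases h : H.Adj i j
    · have hF : F i j = G.labelWeight φ i j * x (φ i) * x (φ j) := by
        rw [labelWeight_eq_adjMatrix G φ h]
      rcases lt_or_gt_of_ne h.ne with hij | hij
      · simp [h, hij, hij.not_gt, hF]
      · rw [hF, labelWeight_comm]
        simp only [h.symm, hij, hij.not_gt, false_and, true_and, if_true, if_false]
        ring
    · have h' : ¬ H.Adj j i := fun k => h k.symm
      have : ¬ G.graph.Adj (φ i) (φ j) := fun k => h (φ.map_adj_iff.1 k)
      simp [F, h, h', G.adjMatrix_apply_of_not_adj this]
  have hx : x ⬝ᵥ G.adjMatrix.mulVec x = ∑ i, ∑ j, F i j := by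
    simp only [dotProduct, Matrix.mulVec]
    rw [← φ.toEquiv.sum_comp]
    refine Finset.sum_congr rfl fun i _ => ?_
    rw [← φ.toEquiv.sum_comp, Finset.mul_sum]
    refine Finset.sum_congr rfl fun j _ => ?_
    change x (φ i) * (G.adjMatrix (φ i) (φ j) * x (φ j)) = _
    ring
  simp only [hx, hF, Finset.sum_add_distrib]
  rw [two_mul]
  congr 1
  exact Finset.sum_comm

/-- Two linear conditions cut out a subspace of codimension at most two. In the applications `u` is
the neighbour of a pendant, so the first one removes `u` and isolates that pendant; `β` is a linear
form adapted to what remains. -/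
theorem posIndex_le_two_of_iso [DecidableRel H.Adj] (u : Fin n) (β : Fin n → ℝ)
    (h : ∀ x : Fin n → ℝ, x u = 0 → ∑ i, β i * x i = 0 →
      (∑ i, ∑ j, if i < j ∧ H.Adj i j then G.labelWeight φ i j * x i * x j else 0) ≤ 0) :
    G.posIndex ≤ 2 := by
  let l : (V → ℝ) →ₗ[ℝ] (Fin 2 → ℝ) := LinearMap.pi
    ![LinearMap.proj (φ u), ∑ i, β i • LinearMap.proj (φ i)]
  refine G.posIndex_le_of_nonpos l fun x hx => ?_
  rw [G.dotProduct_adjMatrix_mulVec φ]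
  have h0 : x (φ u) = 0 := congrFun hx 0
  have h1 : ∑ i, β i * x (φ i) = 0 := by
    simpa [l] using congrFun hx 1
  have := h (x ∘ φ) h0 h1
  simp only [Function.comp_apply] at this
  linarith

include φ in
theorem two_le_posIndex_of_iso (a b c d : Fin n)
    (h : H.Adj a b ∧ H.Adj c d ∧ ¬ H.Adj a c ∧ ¬ H.Adj a d) : 2 ≤ G.posIndex := by
  simp only [← φ.map_adj_iff] at h
  exact G.two_le_posIndex h.1 h.2.1 h.2.2.1 h.2.2.2

/-- The graph has edges `ab`, `cd`, `ef` as in `three_le_posIndex`. -/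
def HasThreeEdges (H : SimpleGraph (Fin n)) : Prop :=
  ∃ a b, H.Adj a b ∧ ∃ c, ¬ H.Adj a c ∧ ∃ d, (H.Adj c d ∧ ¬ H.Adj a d) ∧
    ∃ e, (¬ H.Adj a e ∧ ¬ H.Adj c e) ∧ ∃ f, H.Adj e f ∧ ¬ H.Adj a f ∧ ¬ H.Adj c f

instance [DecidableRel H.Adj] : Decidable (HasThreeEdges H) := by
  unfold HasThreeEdges; infer_instance

include φ in
theorem HasThreeEdges.three_le_posIndex (h : HasThreeEdges H) : 3 ≤ G.posIndex := by
  obtain ⟨a, b, hab, c, hac, d, hd, e, he, f, hf⟩ := h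
  simp only [← φ.map_adj_iff] at hab hac hd he hf
  exact G.three_le_posIndex hab hd.1 hf.1 hac he.1 he.2 hd.2 hf.2.1 hf.2.2

/-- `HasThreeEdges` tests each adjacency as soon as its vertices are chosen, which prunes this
exhaustive search. -/
theorem hasThreeEdges_of_mem_furtherGraphs :
    ∀ H ∈ furtherGraphs, HasThreeEdges (graphOn H.1 H.2) := by
  decide +kernel

end WeightedGraph

/-! ### Adjacency in the eleven graphs -/

instance : DecidableRel graph1.Adj := inferInstanceAs (DecidableRel (graphOn _ _).Adj)
instance : DecidableRel graph2.Adj := inferInstanceAs (DecidableRel (graphOn _ _).Adj)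
instance : DecidableRel graph3.Adj := inferInstanceAs (DecidableRel (graphOn _ _).Adj)
instance : DecidableRel graph4.Adj := inferInstanceAs (DecidableRel (graphOn _ _).Adj)
instance : DecidableRel graph5.Adj := inferInstanceAs (DecidableRel (graphOn _ _).Adj)
instance : DecidableRel graph6.Adj := inferInstanceAs (DecidableRel (graphOn _ _).Adj)
instance : DecidableRel graph7.Adj := inferInstanceAs (DecidableRel (graphOn _ _).Adj)
instance : DecidableRel graph8.Adj := inferInstanceAs (DecidableRel (graphOn _ _).Adj)
instance : DecidableRel graph9.Adj := inferInstanceAs (DecidableRel (graphOn _ _).Adj)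
instance : DecidableRel graph10.Adj := inferInstanceAs (DecidableRel (graphOn _ _).Adj)
instance : DecidableRel graph11.Adj := inferInstanceAs (DecidableRel (graphOn _ _).Adj)

theorem graph1_adj {i j : Fin 6} : graph1.Adj i j ↔ i ≠ j ∧
    ((i.val, j.val) ∈ theta111 ++ [(0, 5)] ∨ (j.val, i.val) ∈ theta111 ++ [(0, 5)]) :=
  graphOn_adj

theorem graph2_adj {i j : Fin 6} : graph2.Adj i j ↔ i ≠ j ∧
    ((i.val, j.val) ∈ theta111 ++ [(4, 5)] ∨ (j.val, i.val) ∈ theta111 ++ [(4, 5)]) :=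
  graphOn_adj

theorem graph3_adj {i j : Fin 7} : graph3.Adj i j ↔ i ≠ j ∧
    ((i.val, j.val) ∈ theta111 ++ [(0, 5), (1, 6)] ∨
      (j.val, i.val) ∈ theta111 ++ [(0, 5), (1, 6)]) :=
  graphOn_adj

theorem graph4_adj {i j : Fin 7} : graph4.Adj i j ↔ i ≠ j ∧
    ((i.val, j.val) ∈ theta111 ++ [(0, 5), (5, 6)] ∨
      (j.val, i.val) ∈ theta111 ++ [(0, 5), (5, 6)]) :=
  graphOn_adj

theorem graph5_adj {i j : Fin 7} : graph5.Adj i j ↔ i ≠ j ∧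
    ((i.val, j.val) ∈ theta111 ++ [(4, 5), (5, 6)] ∨
      (j.val, i.val) ∈ theta111 ++ [(4, 5), (5, 6)]) :=
  graphOn_adj

theorem graph6_adj {i j : Fin 5} : graph6.Adj i j ↔ i ≠ j ∧
    ((i.val, j.val) ∈ theta101 ++ [(0, 4)] ∨ (j.val, i.val) ∈ theta101 ++ [(0, 4)]) :=
  graphOn_adj

theorem graph7_adj {i j : Fin 5} : graph7.Adj i j ↔ i ≠ j ∧
    ((i.val, j.val) ∈ theta101 ++ [(3, 4)] ∨ (j.val, i.val) ∈ theta101 ++ [(3, 4)]) :=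
  graphOn_adj

theorem graph8_adj {i j : Fin 6} : graph8.Adj i j ↔ i ≠ j ∧
    ((i.val, j.val) ∈ theta101 ++ [(0, 4), (1, 5)] ∨
      (j.val, i.val) ∈ theta101 ++ [(0, 4), (1, 5)]) :=
  graphOn_adj

theorem graph9_adj {i j : Fin 6} : graph9.Adj i j ↔ i ≠ j ∧
    ((i.val, j.val) ∈ theta101 ++ [(0, 4), (4, 5)] ∨
      (j.val, i.val) ∈ theta101 ++ [(0, 4), (4, 5)]) :=
  graphOn_adj

theorem graph10_adj {i j : Fin 6} : graph10.Adj i j ↔ i ≠ j ∧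
    ((i.val, j.val) ∈ theta101 ++ [(3, 4), (4, 5)] ∨
      (j.val, i.val) ∈ theta101 ++ [(3, 4), (4, 5)]) :=
  graphOn_adj

theorem graph11_adj {i j : Fin 6} : graph11.Adj i j ↔ i ≠ j ∧
    ((i.val, j.val) ∈ theta201 ++ [(4, 5)] ∨ (j.val, i.val) ∈ theta201 ++ [(4, 5)]) :=
  graphOn_adj

/-! ### The eleven types have index two -/

namespace WeightedGraph

variable {V : Type*} [Fintype V] {G : WeightedGraph V}

/-- The vertices 0 and 1 cover all edges, so the form vanishes once both coordinates do. Types 3, 6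
and 8 work the same way. -/
theorem IsType1.posIndex_eq_two (h : G.IsType1) : G.posIndex = 2 := by
  obtain ⟨φ⟩ := h
  refine le_antisymm (G.posIndex_le_two_of_iso φ 0 ![0, 1, 0, 0, 0, 0] fun x hu hx => ?_)
    (G.two_le_posIndex_of_iso φ 5 0 2 1 (by decide))
  simp [Fin.sum_univ_six] at hx
  simp [Fin.sum_univ_six, graph1_adj, theta111, hu, hx]

/-- Without vertex 4 the rest is a 4-cycle with parts {0, 1} and {2, 3}. The weight condition makes
its 2 × 2 block singular, so the form factors and `β` is one factor. Types 4 and 5 have a rank-one 2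
× 3 block instead. -/
theorem IsType2.posIndex_eq_two (h : G.IsType2) : G.posIndex = 2 := by
  obtain ⟨φ, h⟩ := h
  -- The quadratic form is written with the smaller label of each edge first.
  rw [G.labelWeight_comm φ 3 1, G.labelWeight_comm φ 2 1] at h
  have hp := G.labelWeight_pos φ (i := 0) (j := 2) (by decide)
  refine le_antisymm (G.posIndex_le_two_of_iso φ 4
    ![G.labelWeight φ 0 2, G.labelWeight φ 1 2, 0, 0, 0, 0] fun x hu hx => ?_)
    (G.two_le_posIndex_of_iso φ 5 4 2 1 (by decide))
  simp [Fin.sum_univ_six] at hx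
  simp [Fin.sum_univ_six, graph2_adj, theta111, hu]
  refine le_of_mul_le_mul_left (le_of_eq ?_) hp
  linear_combination (G.labelWeight φ 0 2 * x 2 + G.labelWeight φ 0 3 * x 3) * hx + x 1 * x 3 * h

theorem IsType3.posIndex_eq_two (h : G.IsType3) : G.posIndex = 2 := by
  obtain ⟨φ⟩ := h
  refine le_antisymm (G.posIndex_le_two_of_iso φ 0 ![0, 1, 0, 0, 0, 0, 0] fun x hu hx => ?_)
    (G.two_le_posIndex_of_iso φ 5 0 2 1 (by decide))
  simp [Fin.sum_univ_seven] at hx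
  simp [Fin.sum_univ_seven, graph3_adj, theta111, hu, hx]

theorem IsType4.posIndex_eq_two (h : G.IsType4) : G.posIndex = 2 := by
  obtain ⟨φ, h, h'⟩ := h
  rw [G.labelWeight_comm φ 3 1, G.labelWeight_comm φ 2 1] at h
  rw [G.labelWeight_comm φ 4 1, G.labelWeight_comm φ 2 1] at h'
  have hp := G.labelWeight_pos φ (i := 0) (j := 2) (by decide)
  refine le_antisymm (G.posIndex_le_two_of_iso φ 5
    ![G.labelWeight φ 0 2, G.labelWeight φ 1 2, 0, 0, 0, 0, 0] fun x hu hx => ?_)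
    (G.two_le_posIndex_of_iso φ 6 5 2 1 (by decide))
  simp [Fin.sum_univ_seven] at hx
  simp [Fin.sum_univ_seven, graph4_adj, theta111, hu]
  refine le_of_mul_le_mul_left (le_of_eq ?_) hp
  linear_combination (G.labelWeight φ 0 2 * x 2 + G.labelWeight φ 0 3 * x 3 +
    G.labelWeight φ 0 4 * x 4) * hx +
    x 1 * x 3 * h + x 1 * x 4 * h'

theorem IsType5.posIndex_eq_two (h : G.IsType5) : G.posIndex = 2 := by
  obtain ⟨φ, h, h'⟩ := h
  rw [G.labelWeight_comm φ 3 1, G.labelWeight_comm φ 2 1] at h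
  rw [G.labelWeight_comm φ 4 1, G.labelWeight_comm φ 2 1] at h'
  have hp := G.labelWeight_pos φ (i := 0) (j := 2) (by decide)
  refine le_antisymm (G.posIndex_le_two_of_iso φ 5
    ![G.labelWeight φ 0 2, G.labelWeight φ 1 2, 0, 0, 0, 0, 0] fun x hu hx => ?_)
    (G.two_le_posIndex_of_iso φ 6 5 2 1 (by decide))
  simp [Fin.sum_univ_seven] at hx
  simp [Fin.sum_univ_seven, graph5_adj, theta111, hu]
  refine le_of_mul_le_mul_left (le_of_eq ?_) hp
  linear_combination (G.labelWeight φ 0 2 * x 2 + G.labelWeight φ 0 3 * x 3 +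
    G.labelWeight φ 0 4 * x 4) * hx +
    x 1 * x 3 * h + x 1 * x 4 * h'

theorem IsType6.posIndex_eq_two (h : G.IsType6) : G.posIndex = 2 := by
  obtain ⟨φ⟩ := h
  refine le_antisymm (G.posIndex_le_two_of_iso φ 0 ![0, 1, 0, 0, 0] fun x hu hx => ?_)
    (G.two_le_posIndex_of_iso φ 4 0 2 1 (by decide))
  simp [Fin.sum_univ_five] at hx
  simp [Fin.sum_univ_five, graph6_adj, theta101, hu, hx]

/-- The triangle left after removing vertex 3 has, up to the factor w₀₂, the form (w₀₂x₀ +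
w₁₂x₁)(w₀₁x₁ + w₀₂x₂) − w₀₁w₁₂x₁². The second factor is `β`. In types 9 and 10 the weight condition
lets vertex 3 join that factor with the term w₀₃x₃. -/
theorem IsType7.posIndex_eq_two (h : G.IsType7) : G.posIndex = 2 := by
  obtain ⟨φ⟩ := h
  have hp := G.labelWeight_pos φ (i := 0) (j := 2) (by decide)
  have h01 := G.labelWeight_pos φ (i := 0) (j := 1) (by decide)
  have h12 := G.labelWeight_pos φ (i := 1) (j := 2) (by decide)
  refine le_antisymm (G.posIndex_le_two_of_iso φ 3
    ![0, G.labelWeight φ 0 1, G.labelWeight φ 0 2, 0, 0] fun x hu hx => ?_)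
    (G.two_le_posIndex_of_iso φ 4 3 2 1 (by decide))
  simp [Fin.sum_univ_five] at hx
  simp [Fin.sum_univ_five, graph7_adj, theta101, hu]
  refine le_of_mul_le_mul_left
    (le_of_eq_of_le (b := -(G.labelWeight φ 0 1 * G.labelWeight φ 1 2 * x 1 ^ 2)) ?_ ?_) hp
  · linear_combination (G.labelWeight φ 0 2 * x 0 + G.labelWeight φ 1 2 * x 1) * hx
  · rw [mul_zero, neg_nonpos]
    positivity

theorem IsType8.posIndex_eq_two (h : G.IsType8) : G.posIndex = 2 := by
  obtain ⟨φ⟩ := h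
  refine le_antisymm (G.posIndex_le_two_of_iso φ 0 ![0, 1, 0, 0, 0, 0] fun x hu hx => ?_)
    (G.two_le_posIndex_of_iso φ 4 0 2 1 (by decide))
  simp [Fin.sum_univ_six] at hx
  simp [Fin.sum_univ_six, graph8_adj, theta101, hu, hx]

theorem IsType9.posIndex_eq_two (h : G.IsType9) : G.posIndex = 2 := by
  obtain ⟨φ, h⟩ := h
  rw [G.labelWeight_comm φ 3 1, G.labelWeight_comm φ 2 1] at h
  have hp := G.labelWeight_pos φ (i := 0) (j := 2) (by decide)
  have h01 := G.labelWeight_pos φ (i := 0) (j := 1) (by decide)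
  have h12 := G.labelWeight_pos φ (i := 1) (j := 2) (by decide)
  refine le_antisymm (G.posIndex_le_two_of_iso φ 4
    ![0, G.labelWeight φ 0 1, G.labelWeight φ 0 2, G.labelWeight φ 0 3, 0, 0] fun x hu hx => ?_)
    (G.two_le_posIndex_of_iso φ 5 4 2 1 (by decide))
  simp [Fin.sum_univ_six] at hx
  simp [Fin.sum_univ_six, graph9_adj, theta101, hu]
  refine le_of_mul_le_mul_left
    (le_of_eq_of_le (b := -(G.labelWeight φ 0 1 * G.labelWeight φ 1 2 * x 1 ^ 2)) ?_ ?_) hp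
  · linear_combination (G.labelWeight φ 0 2 * x 0 + G.labelWeight φ 1 2 * x 1) * hx + x 1 * x 3 * h
  · rw [mul_zero, neg_nonpos]
    positivity

theorem IsType10.posIndex_eq_two (h : G.IsType10) : G.posIndex = 2 := by
  obtain ⟨φ, h⟩ := h
  rw [G.labelWeight_comm φ 3 1, G.labelWeight_comm φ 2 1] at h
  have hp := G.labelWeight_pos φ (i := 0) (j := 2) (by decide)
  have h01 := G.labelWeight_pos φ (i := 0) (j := 1) (by decide)
  have h12 := G.labelWeight_pos φ (i := 1) (j := 2) (by decide)
  refine le_antisymm (G.posIndex_le_two_of_iso φ 4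
    ![0, G.labelWeight φ 0 1, G.labelWeight φ 0 2, G.labelWeight φ 0 3, 0, 0] fun x hu hx => ?_)
    (G.two_le_posIndex_of_iso φ 5 4 2 1 (by decide))
  simp [Fin.sum_univ_six] at hx
  simp [Fin.sum_univ_six, graph10_adj, theta101, hu]
  refine le_of_mul_le_mul_left
    (le_of_eq_of_le (b := -(G.labelWeight φ 0 1 * G.labelWeight φ 1 2 * x 1 ^ 2)) ?_ ?_) hp
  · linear_combination (G.labelWeight φ 0 2 * x 0 + G.labelWeight φ 1 2 * x 1) * hx + x 1 * x 3 * h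
  · rw [mul_zero, neg_nonpos]
    positivity

/-- Here the remaining 4-cycle has parts {0, 3} and {1, 2}. -/
theorem IsType11.posIndex_eq_two (h : G.IsType11) : G.posIndex = 2 := by
  obtain ⟨φ, h⟩ := h
  rw [G.labelWeight_comm φ 3 1] at h
  have hp := G.labelWeight_pos φ (i := 0) (j := 2) (by decide)
  refine le_antisymm (G.posIndex_le_two_of_iso φ 4
    ![G.labelWeight φ 0 2, 0, 0, G.labelWeight φ 2 3, 0, 0] fun x hu hx => ?_)
    (G.two_le_posIndex_of_iso φ 5 4 2 3 (by decide))
  simp [Fin.sum_univ_six] at hx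
  simp [Fin.sum_univ_six, graph11_adj, theta201, hu]
  refine le_of_mul_le_mul_left (le_of_eq ?_) hp
  linear_combination (G.labelWeight φ 0 2 * x 2 + G.labelWeight φ 0 1 * x 1) * hx + x 1 * x 3 * h

end WeightedGraph

/-! ### Complete multipartite rests -/

/-- Deleting the pendant `v` and its neighbour `u` leaves the complete multipartite graph with
the classes `X`, `Y`, `Z`, some of which may be empty. -/
structure IsPendantTripartition {V : Type*} (S : SimpleGraph V) (u v : V) (X Y Z : Finset V) :
    Prop where
  adj_pendant : ∀ w, S.Adj v w ↔ w = u
  cover : ∀ w, w = u ∨ w = v ∨ w ∈ X ∨ w ∈ Y ∨ w ∈ Z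
  notMem₁ : u ∉ X ∧ v ∉ X
  notMem₂ : u ∉ Y ∧ v ∉ Y
  notMem₃ : u ∉ Z ∧ v ∉ Z
  indep₁ : ∀ a ∈ X, ∀ b ∈ X, ¬ S.Adj a b
  indep₂ : ∀ a ∈ Y, ∀ b ∈ Y, ¬ S.Adj a b
  indep₃ : ∀ a ∈ Z, ∀ b ∈ Z, ¬ S.Adj a b
  adj₁₂ : ∀ a ∈ X, ∀ b ∈ Y, S.Adj a b
  adj₁₃ : ∀ a ∈ X, ∀ b ∈ Z, S.Adj a b
  adj₂₃ : ∀ a ∈ Y, ∀ b ∈ Z, S.Adj a b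

namespace IsPendantTripartition

variable {V : Type*} {S : SimpleGraph V} {u v : V} {X Y Z : Finset V}

theorem swap₁₂ (h : IsPendantTripartition S u v X Y Z) : IsPendantTripartition S u v Y X Z where
  adj_pendant := h.adj_pendant
  cover w := by have := h.cover w; tauto
  notMem₁ := h.notMem₂
  notMem₂ := h.notMem₁
  notMem₃ := h.notMem₃
  indep₁ := h.indep₂
  indep₂ := h.indep₁
  indep₃ := h.indep₃
  adj₁₂ a ha b hb := (h.adj₁₂ b hb a ha).symm
  adj₁₃ := h.adj₂₃
  adj₂₃ := h.adj₁₃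

theorem swap₂₃ (h : IsPendantTripartition S u v X Y Z) : IsPendantTripartition S u v X Z Y where
  adj_pendant := h.adj_pendant
  cover w := by have := h.cover w; tauto
  notMem₁ := h.notMem₁
  notMem₂ := h.notMem₃
  notMem₃ := h.notMem₂
  indep₁ := h.indep₁
  indep₂ := h.indep₃
  indep₃ := h.indep₂
  adj₁₂ := h.adj₁₃
  adj₁₃ := h.adj₁₂
  adj₂₃ a ha b hb := (h.adj₂₃ b hb a ha).symm

end IsPendantTripartition

/-! ### Edge counts -/

section Count

variable {V : Type*} [Fintype V] {S : SimpleGraph V}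

open Classical in
theorem two_mul_ncard_edgeSet : 2 * S.edgeSet.ncard = ∑ a, ∑ b, if S.Adj a b then 1 else 0 := by
  have h : S.edgeSet.ncard = S.edgeFinset.card := by
    rw [← SimpleGraph.coe_edgeFinset, Set.ncard_coe_finset]
  rw [h, ← S.sum_degrees_eq_twice_card_edges]
  refine Finset.sum_congr rfl fun a _ => ?_
  rw [← SimpleGraph.card_neighborFinset_eq_degree, SimpleGraph.neighborFinset_eq_filter,
    Finset.card_filter]

open Classical in
/-- Edge count of a bicyclic graph in which `v` is a pendant with neighbour `u` and the
remaining vertices are split into two independent classes `X`, `Y` and a rest `Z`, any two of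
the three being completely joined. -/
theorem card_add_card_of_isBicyclic {u v : V} {X Y Z : Finset V} (hS : IsBicyclic S)
    (hv : ∀ w, S.Adj v w ↔ w = u)
    (hsplit : ∀ g : V → ℕ, ∑ w, g w = g u + g v + ∑ w ∈ X, g w + ∑ w ∈ Y, g w + ∑ w ∈ Z, g w)
    (hXu : u ∉ X) (hYu : u ∉ Y) (hZu : u ∉ Z)
    (hX : ∀ a ∈ X, ∀ b ∈ X, ¬ S.Adj a b) (hY : ∀ a ∈ Y, ∀ b ∈ Y, ¬ S.Adj a b)
    (hXY : ∀ a ∈ X, ∀ b ∈ Y, S.Adj a b) (hXZ : ∀ a ∈ X, ∀ b ∈ Z, S.Adj a b)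
    (hYZ : ∀ a ∈ Y, ∀ b ∈ Z, S.Adj a b) :
    2 * ((X.filter (S.Adj u)).card + (Y.filter (S.Adj u)).card + (Z.filter (S.Adj u)).card) +
      2 * (X.card * Y.card + X.card * Z.card + Y.card * Z.card) +
      ∑ a ∈ Z, ∑ b ∈ Z, (if S.Adj a b then 1 else 0) = 2 * (X.card + Y.card + Z.card) + 4 := by
  have hcard : Fintype.card V = X.card + Y.card + Z.card + 2 := by
    have := hsplit fun _ => 1
    simp only [Finset.sum_const, Finset.card_univ, smul_eq_mul, mul_one] at this
    omega
  have hE := two_mul_ncard_edgeSet (S := S)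
  rw [hS.2, hcard] at hE
  let f : V → V → ℕ := fun a b => if S.Adj a b then 1 else 0
  have hf1 : ∀ {a b}, S.Adj a b → f a b = 1 := fun h => if_pos h
  have hf0 : ∀ {a b}, ¬ S.Adj a b → f a b = 0 := fun h => if_neg h
  have hfs : ∀ a b, f a b = f b a := fun a b => by simp only [f, S.adj_comm]
  have full : ∀ A B : Finset V, (∀ a ∈ A, ∀ b ∈ B, S.Adj a b) →
      ∑ a ∈ A, ∑ b ∈ B, f a b = A.card * B.card := fun A B h => by
    rw [Finset.sum_congr rfl fun a ha => Finset.sum_congr rfl fun b hb => hf1 (h a ha b hb)]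
    simp
  have none' : ∀ A B : Finset V, (∀ a ∈ A, ∀ b ∈ B, ¬ S.Adj a b) →
      ∑ a ∈ A, ∑ b ∈ B, f a b = 0 := fun A B h =>
    Finset.sum_eq_zero fun a ha => Finset.sum_eq_zero fun b hb => hf0 (h a ha b hb)
  have hvA : ∀ A : Finset V, u ∉ A → ∑ a ∈ A, f v a = 0 := fun A h =>
    Finset.sum_eq_zero fun a ha => hf0 fun k => h ((hv a).1 k ▸ ha)
  have hvA' : ∀ A : Finset V, u ∉ A → ∑ a ∈ A, f a v = 0 := fun A h => by
    simp only [fun a => hfs a v, hvA A h]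
  have huA : ∀ A : Finset V, ∑ a ∈ A, f u a = (A.filter (S.Adj u)).card := fun A =>
    (Finset.card_filter _ _).symm
  have huA' : ∀ A : Finset V, ∑ a ∈ A, f a u = (A.filter (S.Adj u)).card := fun A => by
    simp only [fun a => hfs a u, huA A]
  have hvu := (hv u).2 rfl
  change _ = ∑ a, ∑ b, f a b at hE
  simp only [hsplit, Finset.sum_add_distrib, huA, huA', hvA _ hXu, hvA _ hYu, hvA _ hZu,
    hvA' _ hXu, hvA' _ hYu, hvA' _ hZu, hf1 hvu, hf1 hvu.symm,
    hf0 (S.loopless.irrefl u), hf0 (S.loopless.irrefl v), none' X X hX, none' Y Y hY,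
    full X Y hXY, full X Z hXZ, full Y Z hYZ, full Y X fun a ha b hb => (hXY b hb a ha).symm,
    full Z X fun a ha b hb => (hXZ b hb a ha).symm,
    full Z Y fun a ha b hb => (hYZ b hb a ha).symm] at hE
  change _ + ∑ a ∈ Z, ∑ b ∈ Z, f a b = _
  rw [mul_comm Y.card X.card, mul_comm Z.card X.card, mul_comm Z.card Y.card] at hE
  omega

open Classical in
theorem sum_eq_of_cover {u v : V} {X Y Z : Finset V} (huv : u ≠ v)
    (hcover : ∀ w, w = u ∨ w = v ∨ w ∈ X ∨ w ∈ Y ∨ w ∈ Z) (hX : u ∉ X ∧ v ∉ X)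
    (hY : u ∉ Y ∧ v ∉ Y) (hZ : u ∉ Z ∧ v ∉ Z) (hXY : ∀ a ∈ X, ∀ b ∈ Y, S.Adj a b)
    (hXZ : ∀ a ∈ X, ∀ b ∈ Z, S.Adj a b) (hYZ : ∀ a ∈ Y, ∀ b ∈ Z, S.Adj a b) (g : V → ℕ) :
    ∑ w, g w = g u + g v + ∑ w ∈ X, g w + ∑ w ∈ Y, g w + ∑ w ∈ Z, g w := by
  -- A common vertex of two completely joined sets would be adjacent to itself.
  have disj : ∀ A B : Finset V, (∀ a ∈ A, ∀ b ∈ B, S.Adj a b) → Disjoint A B := fun A B h =>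
    Finset.disjoint_left.2 fun a ha hb => S.loopless.irrefl a (h a ha a hb)
  have huniv : (Finset.univ : Finset V) = insert u (insert v (X ∪ Y ∪ Z)) := by
    ext w
    have := hcover w
    simp only [Finset.mem_univ, Finset.mem_insert, Finset.mem_union, true_iff]
    tauto
  rw [huniv, Finset.sum_insert (by simp [huv, hX, hY, hZ]),
    Finset.sum_insert (by simp [hX, hY, hZ]),
    Finset.sum_union (Finset.disjoint_union_left.2 ⟨disj _ _ hXZ, disj _ _ hYZ⟩),
    Finset.sum_union (disj _ _ hXY)]
  ring

open Classical in
theorem IsPendantTripartition.card_add_card {u v : V} {X Y Z : Finset V}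
    (h : IsPendantTripartition S u v X Y Z) (hS : IsBicyclic S) :
    ((X.filter (S.Adj u)).card + (Y.filter (S.Adj u)).card + (Z.filter (S.Adj u)).card) +
      (X.card * Y.card + X.card * Z.card + Y.card * Z.card) =
      X.card + Y.card + Z.card + 2 := by
  have huv : u ≠ v := ((h.adj_pendant u).2 rfl).ne'
  have := card_add_card_of_isBicyclic hS h.adj_pendant (sum_eq_of_cover huv h.cover h.notMem₁
    h.notMem₂ h.notMem₃ h.adj₁₂ h.adj₁₃ h.adj₂₃) h.notMem₁.1 h.notMem₂.1 h.notMem₃.1 h.indep₁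
    h.indep₂ h.adj₁₂ h.adj₁₃ h.adj₂₃
  rw [Finset.sum_eq_zero fun a ha => Finset.sum_eq_zero fun b hb => if_neg (h.indep₃ a ha b hb)]
    at this
  omega

open Classical in
/-- A bicyclic graph in which nonadjacency is transitive after deleting a pendant `v` and its
neighbour `u` has a complete multipartite rest with at most three classes. -/
theorem exists_isPendantTripartition {u v x y : V} (hS : IsBicyclic S)
    (hv : ∀ w, S.Adj v w ↔ w = u) (hx : x ≠ u) (hy : y ≠ u) (hxy : S.Adj x y)
    (hu : ∃ w, w ≠ v ∧ S.Adj u w)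
    (htrans : ∀ a b c, a ≠ u → b ≠ u → c ≠ u → c ≠ v → S.Adj a b → S.Adj c a ∨ S.Adj c b) :
    ∃ X Y Z, IsPendantTripartition S u v X Y Z ∧ X.Nonempty ∧ Y.Nonempty := by
  have hvu : v ≠ u := ((hv u).2 rfl).ne
  have hxv : x ≠ v := by rintro rfl; exact hy ((hv y).1 hxy)
  have hyv : y ≠ v := by rintro rfl; exact hx ((hv x).1 hxy.symm)
  -- `X` and `Y` are the nonadjacency classes of `x` and `y`; `Z` collects all remaining vertices
  -- and could still contain edges.
  let X := Finset.univ.filter fun w => w ≠ u ∧ w ≠ v ∧ ¬ S.Adj w x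
  let Y := Finset.univ.filter fun w => w ≠ u ∧ w ≠ v ∧ ¬ S.Adj w y
  let Z := Finset.univ.filter fun w => w ≠ u ∧ w ≠ v ∧ S.Adj w x ∧ S.Adj w y
  have hX : ∀ w, w ∈ X ↔ w ≠ u ∧ w ≠ v ∧ ¬ S.Adj w x := by simp [X]
  have hY : ∀ w, w ∈ Y ↔ w ≠ u ∧ w ≠ v ∧ ¬ S.Adj w y := by simp [Y]
  have hZ : ∀ w, w ∈ Z ↔ w ≠ u ∧ w ≠ v ∧ S.Adj w x ∧ S.Adj w y := by simp [Z]
  have hxX : x ∈ X := (hX x).2 ⟨hx, hxv, S.loopless.irrefl x⟩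
  have hyY : y ∈ Y := (hY y).2 ⟨hy, hyv, S.loopless.irrefl y⟩
  have cover : ∀ w, w = u ∨ w = v ∨ w ∈ X ∨ w ∈ Y ∨ w ∈ Z := fun w => by
    rw [hX, hY, hZ]; tauto
  have hXm : u ∉ X ∧ v ∉ X := by simp [hX]
  have hYm : u ∉ Y ∧ v ∉ Y := by simp [hY]
  have hZm : u ∉ Z ∧ v ∉ Z := by simp [hZ]
  have key : ∀ {a b c}, a ≠ u → b ≠ u → c ≠ u → c ≠ v → S.Adj a b → ¬ S.Adj c a → S.Adj c b :=
    fun ha hb hc hc' hab h => (htrans _ _ _ ha hb hc hc' hab).resolve_left h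
  have hXX : ∀ a ∈ X, ∀ b ∈ X, ¬ S.Adj a b := fun a ha b hb hab => by
    rw [hX] at ha hb
    exact (htrans a b x ha.1 hb.1 hx hxv hab).elim (fun h => ha.2.2 h.symm)
      fun h => hb.2.2 h.symm
  have hYY : ∀ a ∈ Y, ∀ b ∈ Y, ¬ S.Adj a b := fun a ha b hb hab => by
    rw [hY] at ha hb
    exact (htrans a b y ha.1 hb.1 hy hyv hab).elim (fun h => ha.2.2 h.symm)
      fun h => hb.2.2 h.symm
  have hXY : ∀ a ∈ X, ∀ b ∈ Y, S.Adj a b := fun a ha b hb => by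
    rw [hX] at ha
    rw [hY] at hb
    exact (key hy ha.1 hb.1 hb.2.1 (key hx hy ha.1 ha.2.1 hxy ha.2.2).symm hb.2.2).symm
  have hXZ : ∀ a ∈ X, ∀ b ∈ Z, S.Adj a b := fun a ha b hb => by
    rw [hX] at ha
    rw [hZ] at hb
    exact key hx hb.1 ha.1 ha.2.1 hb.2.2.1.symm ha.2.2
  have hYZ : ∀ a ∈ Y, ∀ b ∈ Z, S.Adj a b := fun a ha b hb => by
    rw [hY] at ha
    rw [hZ] at hb
    exact key hy hb.1 ha.1 ha.2.1 hb.2.2.2.symm ha.2.2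
  have hcount := card_add_card_of_isBicyclic hS hv (sum_eq_of_cover hvu.symm cover hXm hYm hZm
    hXY hXZ hYZ) hXm.1 hYm.1 hZm.1 hXX hYY hXY hXZ hYZ
  refine ⟨X, Y, Z, ⟨hv, cover, hXm, hYm, hZm, hXX, hYY, ?_, hXY, hXZ, hYZ⟩, ⟨x, hxX⟩, ⟨y, hyY⟩⟩
  have hd : 0 < (X.filter (S.Adj u)).card + (Y.filter (S.Adj u)).card +
      (Z.filter (S.Adj u)).card := by
    obtain ⟨w, hw, huw⟩ := hu
    rcases cover w with rfl | rfl | h | h | h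
    · exact (S.loopless.irrefl _ huw).elim
    · exact (hw rfl).elim
    · have := Finset.card_pos.2 ⟨w, Finset.mem_filter.2 ⟨h, huw⟩⟩
      omega
    · have := Finset.card_pos.2 ⟨w, Finset.mem_filter.2 ⟨h, huw⟩⟩
      omega
    · have := Finset.card_pos.2 ⟨w, Finset.mem_filter.2 ⟨h, huw⟩⟩
      omega
  intro a ha b hb hab
  -- An edge inside `Z` would complete a `K₄` with one vertex each of `X` and `Y`; as `u` has a
  -- neighbour besides `v`, the edge count is then too large.
  have hE : 2 ≤ ∑ a ∈ Z, ∑ b ∈ Z, (if S.Adj a b then 1 else 0) := by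
    have hle : ∑ c ∈ {a, b}, ∑ d ∈ {a, b}, (if S.Adj c d then 1 else 0) ≤
        ∑ a ∈ Z, ∑ b ∈ Z, (if S.Adj a b then 1 else 0) := by
      have hsub : ({a, b} : Finset V) ⊆ Z := by
        intro w hw
        simp only [Finset.mem_insert, Finset.mem_singleton] at hw
        rcases hw with rfl | rfl <;> assumption
      exact (Finset.sum_le_sum fun c _ => Finset.sum_le_sum_of_subset hsub).trans
        (Finset.sum_le_sum_of_subset hsub)
    rw [Finset.sum_pair hab.ne, Finset.sum_pair hab.ne, Finset.sum_pair hab.ne] at hle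
    simpa [hab, hab.symm] using hle
  have hr : 2 ≤ Z.card := Finset.one_lt_card.2 ⟨a, ha, b, hb, hab.ne⟩
  have hp : 1 ≤ X.card := Finset.card_pos.2 ⟨x, hxX⟩
  have hq : 1 ≤ Y.card := Finset.card_pos.2 ⟨y, hyY⟩
  nlinarith [Nat.mul_le_mul hp hr, Nat.mul_le_mul hq hr, Nat.mul_le_mul hp hq]

end Count

/-! ### Recognizing the eleven graphs -/

section Iso

variable {V : Type*} {S : SimpleGraph V}

theorem nonempty_iso_of_enumeration {n : ℕ} {H : SimpleGraph (Fin n)} (f : Fin n → V)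
    (hf : ∀ w, ∃ i, f i = w)
    (h : ∀ i j, i < j → f i ≠ f j ∧ (S.Adj (f i) (f j) ↔ H.Adj i j)) : Nonempty (H ≃g S) := by
  have hinj : Function.Injective f := fun i j hij => by
    rcases lt_trichotomy i j with k | k | k
    · exact ((h i j k).1 hij).elim
    · exact k
    · exact ((h j i k).1 hij.symm).elim
  refine ⟨Equiv.ofBijective f ⟨hinj, hf⟩, fun {i j} => ?_⟩
  change S.Adj (f i) (f j) ↔ H.Adj i j
  rcases lt_trichotomy i j with k | rfl | k
  · exact (h i j k).2
  · exact iff_of_false (S.loopless.irrefl _) (H.loopless.irrefl _)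
  · rw [S.adj_comm, H.adj_comm]
    exact (h j i k).2

namespace IsPendantTripartition

variable [DecidableEq V] {u v a b c d e : V}

/-- Here, as for graphs 3, 6 and 8, `u` is itself a vertex of degree three of the base. In graphs 7
and 11 it is an inner vertex carrying the pendant, in graph 2 as well, and in graphs 4, 5, 9 and 10
it lies on the attached path. -/
theorem nonempty_iso_graph1 (h : IsPendantTripartition S u v {a} {b, c, d} ∅)
    (hbc : b ≠ c) (hbd : b ≠ d) (hcd : c ≠ d) (ha : ¬ S.Adj u a) (hb : S.Adj u b) (hc : S.Adj u c)
    (hd : S.Adj u d) : Nonempty (graph1 ≃g S) := by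
  obtain ⟨hv, cover, m₁, m₂, -, i₁, i₂, -, a₁₂, -, -⟩ := h
  simp only [Finset.mem_insert, Finset.mem_singleton, Finset.notMem_empty, forall_eq_or_imp,
    forall_eq, not_or, or_false]
    at cover m₁ m₂ i₁ i₂ a₁₂
  refine nonempty_iso_of_enumeration ![u, a, b, c, d, v] (fun w => ?_) ?_
  · have := cover w
    simp [Fin.exists_fin_succ]
    grind
  · simp [Fin.forall_fin_succ, graph1_adj, theta111, S.adj_comm]
    grind [S.adj_comm]

theorem nonempty_iso_graph2 (h : IsPendantTripartition S u v {a, b} {c, d} ∅)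
    (hab : a ≠ b) (hcd : c ≠ d) (ha : S.Adj u a) (hb : S.Adj u b) (hc : ¬ S.Adj u c)
    (hd : ¬ S.Adj u d) : Nonempty (graph2 ≃g S) := by
  obtain ⟨hv, cover, m₁, m₂, -, i₁, i₂, -, a₁₂, -, -⟩ := h
  simp only [Finset.mem_insert, Finset.mem_singleton, Finset.notMem_empty, forall_eq_or_imp,
    forall_eq, not_or, or_false]
    at cover m₁ m₂ i₁ i₂ a₁₂
  refine nonempty_iso_of_enumeration ![a, b, c, d, u, v] (fun w => ?_) ?_
  · have := cover w
    simp [Fin.exists_fin_succ]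
    grind
  · simp [Fin.forall_fin_succ, graph2_adj, theta111, S.adj_comm]
    grind [S.adj_comm]

theorem nonempty_iso_graph3 (h : IsPendantTripartition S u v {a} {b, c, d, e} ∅)
    (hbc : b ≠ c) (hbd : b ≠ d) (hbe : b ≠ e) (hcd : c ≠ d) (hce : c ≠ e) (hde : d ≠ e)
    (ha : ¬ S.Adj u a) (hb : S.Adj u b) (hc : S.Adj u c) (hd : S.Adj u d) (he : ¬ S.Adj u e) :
    Nonempty (graph3 ≃g S) := by
  obtain ⟨hv, cover, m₁, m₂, -, i₁, i₂, -, a₁₂, -, -⟩ := h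
  simp only [Finset.mem_insert, Finset.mem_singleton, Finset.notMem_empty, forall_eq_or_imp,
    forall_eq, not_or, or_false]
    at cover m₁ m₂ i₁ i₂ a₁₂
  refine nonempty_iso_of_enumeration ![u, a, b, c, d, v, e] (fun w => ?_) ?_
  · have := cover w
    simp [Fin.exists_fin_succ]
    grind
  · simp [Fin.forall_fin_succ, graph3_adj, theta111, S.adj_comm]
    grind [S.adj_comm]

theorem nonempty_iso_graph4 (h : IsPendantTripartition S u v {a, b} {c, d, e} ∅)
    (hab : a ≠ b) (hcd : c ≠ d) (hce : c ≠ e) (hde : d ≠ e) (ha : S.Adj u a) (hb : ¬ S.Adj u b)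
    (hc : ¬ S.Adj u c) (hd : ¬ S.Adj u d) (he : ¬ S.Adj u e) : Nonempty (graph4 ≃g S) := by
  obtain ⟨hv, cover, m₁, m₂, -, i₁, i₂, -, a₁₂, -, -⟩ := h
  simp only [Finset.mem_insert, Finset.mem_singleton, Finset.notMem_empty, forall_eq_or_imp,
    forall_eq, not_or, or_false]
    at cover m₁ m₂ i₁ i₂ a₁₂
  refine nonempty_iso_of_enumeration ![a, b, c, d, e, u, v] (fun w => ?_) ?_
  · have := cover w
    simp [Fin.exists_fin_succ]
    grind
  · simp [Fin.forall_fin_succ, graph4_adj, theta111, S.adj_comm]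
    grind [S.adj_comm]

theorem nonempty_iso_graph5 (h : IsPendantTripartition S u v {a, b} {c, d, e} ∅)
    (hab : a ≠ b) (hcd : c ≠ d) (hce : c ≠ e) (hde : d ≠ e) (ha : ¬ S.Adj u a) (hb : ¬ S.Adj u b)
    (hc : S.Adj u c) (hd : ¬ S.Adj u d) (he : ¬ S.Adj u e) : Nonempty (graph5 ≃g S) := by
  obtain ⟨hv, cover, m₁, m₂, -, i₁, i₂, -, a₁₂, -, -⟩ := h
  simp only [Finset.mem_insert, Finset.mem_singleton, Finset.notMem_empty, forall_eq_or_imp,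
    forall_eq, not_or, or_false]
    at cover m₁ m₂ i₁ i₂ a₁₂
  refine nonempty_iso_of_enumeration ![a, b, d, e, c, u, v] (fun w => ?_) ?_
  · have := cover w
    simp [Fin.exists_fin_succ]
    grind
  · simp [Fin.forall_fin_succ, graph5_adj, theta111, S.adj_comm]
    grind [S.adj_comm]

theorem nonempty_iso_graph6 (h : IsPendantTripartition S u v {a} {b, c} ∅)
    (hbc : b ≠ c) (ha : S.Adj u a) (hb : S.Adj u b) (hc : S.Adj u c) :
    Nonempty (graph6 ≃g S) := by
  obtain ⟨hv, cover, m₁, m₂, -, i₁, i₂, -, a₁₂, -, -⟩ := h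
  simp only [Finset.mem_insert, Finset.mem_singleton, Finset.notMem_empty, forall_eq_or_imp,
    forall_eq, not_or, or_false]
    at cover m₁ m₂ i₁ i₂ a₁₂
  refine nonempty_iso_of_enumeration ![u, a, b, c, v] (fun w => ?_) ?_
  · have := cover w
    simp [Fin.exists_fin_succ]
    grind
  · simp [Fin.forall_fin_succ, graph6_adj, theta101, S.adj_comm]
    grind [S.adj_comm]

omit [DecidableEq V] in
theorem nonempty_iso_graph7 (h : IsPendantTripartition S u v {a} {b} {c})
    (ha : S.Adj u a) (hb : S.Adj u b) (hc : ¬ S.Adj u c) : Nonempty (graph7 ≃g S) := by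
  obtain ⟨hv, cover, m₁, m₂, m₃, i₁, i₂, i₃, a₁₂, a₁₃, a₂₃⟩ := h
  simp only [Finset.mem_singleton, forall_eq]
    at cover m₁ m₂ m₃ i₁ i₂ i₃ a₁₂ a₁₃ a₂₃
  refine nonempty_iso_of_enumeration ![a, b, c, u, v] (fun w => ?_) ?_
  · have := cover w
    simp [Fin.exists_fin_succ]
    grind
  · simp [Fin.forall_fin_succ, graph7_adj, theta101, S.adj_comm]
    grind [S.adj_comm]

theorem nonempty_iso_graph8 (h : IsPendantTripartition S u v {a} {b, c, d} ∅)
    (hbc : b ≠ c) (hbd : b ≠ d) (hcd : c ≠ d) (ha : S.Adj u a) (hb : S.Adj u b) (hc : S.Adj u c)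
    (hd : ¬ S.Adj u d) : Nonempty (graph8 ≃g S) := by
  obtain ⟨hv, cover, m₁, m₂, -, i₁, i₂, -, a₁₂, -, -⟩ := h
  simp only [Finset.mem_insert, Finset.mem_singleton, Finset.notMem_empty, forall_eq_or_imp,
    forall_eq, not_or, or_false]
    at cover m₁ m₂ i₁ i₂ a₁₂
  refine nonempty_iso_of_enumeration ![u, a, b, c, v, d] (fun w => ?_) ?_
  · have := cover w
    simp [Fin.exists_fin_succ]
    grind
  · simp [Fin.forall_fin_succ, graph8_adj, theta101, S.adj_comm]
    grind [S.adj_comm]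

theorem nonempty_iso_graph9 (h : IsPendantTripartition S u v {a} {b} {c, d})
    (hcd : c ≠ d) (ha : S.Adj u a) (hb : ¬ S.Adj u b) (hc : ¬ S.Adj u c) (hd : ¬ S.Adj u d) :
    Nonempty (graph9 ≃g S) := by
  obtain ⟨hv, cover, m₁, m₂, m₃, i₁, i₂, i₃, a₁₂, a₁₃, a₂₃⟩ := h
  simp only [Finset.mem_insert, Finset.mem_singleton, forall_eq_or_imp, forall_eq, not_or]
    at cover m₁ m₂ m₃ i₁ i₂ i₃ a₁₂ a₁₃ a₂₃
  refine nonempty_iso_of_enumeration ![a, b, c, d, u, v] (fun w => ?_) ?_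
  · have := cover w
    simp [Fin.exists_fin_succ]
    grind
  · simp [Fin.forall_fin_succ, graph9_adj, theta101, S.adj_comm]
    grind [S.adj_comm]

theorem nonempty_iso_graph10 (h : IsPendantTripartition S u v {a} {b} {c, d})
    (hcd : c ≠ d) (ha : ¬ S.Adj u a) (hb : ¬ S.Adj u b) (hc : S.Adj u c) (hd : ¬ S.Adj u d) :
    Nonempty (graph10 ≃g S) := by
  obtain ⟨hv, cover, m₁, m₂, m₃, i₁, i₂, i₃, a₁₂, a₁₃, a₂₃⟩ := h
  simp only [Finset.mem_insert, Finset.mem_singleton, forall_eq_or_imp, forall_eq, not_or]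
    at cover m₁ m₂ m₃ i₁ i₂ i₃ a₁₂ a₁₃ a₂₃
  refine nonempty_iso_of_enumeration ![a, b, d, c, u, v] (fun w => ?_) ?_
  · have := cover w
    simp [Fin.exists_fin_succ]
    grind
  · simp [Fin.forall_fin_succ, graph10_adj, theta101, S.adj_comm]
    grind [S.adj_comm]

theorem nonempty_iso_graph11 (h : IsPendantTripartition S u v {a, b} {c, d} ∅)
    (hab : a ≠ b) (hcd : c ≠ d) (ha : S.Adj u a) (hb : ¬ S.Adj u b) (hc : S.Adj u c)
    (hd : ¬ S.Adj u d) : Nonempty (graph11 ≃g S) := by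
  obtain ⟨hv, cover, m₁, m₂, -, i₁, i₂, -, a₁₂, -, -⟩ := h
  simp only [Finset.mem_insert, Finset.mem_singleton, Finset.notMem_empty, forall_eq_or_imp,
    forall_eq, not_or, or_false]
    at cover m₁ m₂ i₁ i₂ a₁₂
  refine nonempty_iso_of_enumeration ![a, c, d, b, u, v] (fun w => ?_) ?_
  · have := cover w
    simp [Fin.exists_fin_succ]
    grind
  · simp [Fin.forall_fin_succ, graph11_adj, theta201, S.adj_comm]
    grind [S.adj_comm]

end IsPendantTripartition

end Iso

/-! ### Solving the edge-count equation -/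

/-- `S` is one of the eleven graphs `graph1`, …, `graph11`. -/
def IsListed {V : Type*} (S : SimpleGraph V) : Prop :=
  Nonempty (graph1 ≃g S) ∨ Nonempty (graph2 ≃g S) ∨ Nonempty (graph3 ≃g S) ∨
  Nonempty (graph4 ≃g S) ∨ Nonempty (graph5 ≃g S) ∨ Nonempty (graph6 ≃g S) ∨
  Nonempty (graph7 ≃g S) ∨ Nonempty (graph8 ≃g S) ∨ Nonempty (graph9 ≃g S) ∨
  Nonempty (graph10 ≃g S) ∨ Nonempty (graph11 ≃g S)

/-- The possible sizes of the classes of the rest of a bicyclic graph, where in each class the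
neighbours (index `1`) of the neighbour of the pendant are separated from the other vertices
(index `0`), and the classes are ordered by size. -/
def IsSizeVector (x₁ x₀ y₁ y₀ z₁ z₀ : ℕ) : Prop :=
  x₁ = 0 ∧ x₀ = 1 ∧ y₁ = 3 ∧ y₀ = 0 ∧ z₁ = 0 ∧ z₀ = 0 ∨
    x₁ = 2 ∧ x₀ = 0 ∧ y₁ = 0 ∧ y₀ = 2 ∧ z₁ = 0 ∧ z₀ = 0 ∨
    x₁ = 0 ∧ x₀ = 2 ∧ y₁ = 2 ∧ y₀ = 0 ∧ z₁ = 0 ∧ z₀ = 0 ∨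
    x₁ = 0 ∧ x₀ = 1 ∧ y₁ = 3 ∧ y₀ = 1 ∧ z₁ = 0 ∧ z₀ = 0 ∨
    x₁ = 1 ∧ x₀ = 1 ∧ y₁ = 0 ∧ y₀ = 3 ∧ z₁ = 0 ∧ z₀ = 0 ∨
    x₁ = 0 ∧ x₀ = 2 ∧ y₁ = 1 ∧ y₀ = 2 ∧ z₁ = 0 ∧ z₀ = 0 ∨
    x₁ = 1 ∧ x₀ = 0 ∧ y₁ = 2 ∧ y₀ = 0 ∧ z₁ = 0 ∧ z₀ = 0 ∨
    x₁ = 1 ∧ x₀ = 0 ∧ y₁ = 1 ∧ y₀ = 0 ∧ z₁ = 0 ∧ z₀ = 1 ∨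
    x₁ = 1 ∧ x₀ = 0 ∧ y₁ = 0 ∧ y₀ = 1 ∧ z₁ = 1 ∧ z₀ = 0 ∨
    x₁ = 0 ∧ x₀ = 1 ∧ y₁ = 1 ∧ y₀ = 0 ∧ z₁ = 1 ∧ z₀ = 0 ∨
    x₁ = 1 ∧ x₀ = 0 ∧ y₁ = 2 ∧ y₀ = 1 ∧ z₁ = 0 ∧ z₀ = 0 ∨
    x₁ = 1 ∧ x₀ = 0 ∧ y₁ = 0 ∧ y₀ = 2 ∧ z₁ = 0 ∧ z₀ = 1 ∨
    x₁ = 0 ∧ x₀ = 1 ∧ y₁ = 0 ∧ y₀ = 2 ∧ z₁ = 1 ∧ z₀ = 0 ∨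
    x₁ = 0 ∧ x₀ = 1 ∧ y₁ = 1 ∧ y₀ = 1 ∧ z₁ = 0 ∧ z₀ = 1 ∨
    x₁ = 1 ∧ x₀ = 1 ∧ y₁ = 1 ∧ y₀ = 1 ∧ z₁ = 0 ∧ z₀ = 0

/-- The products outgrow the linear side of `h` unless the two smaller classes are tiny. The
hypothesis `ht` encodes the absence of pendant twins. -/
theorem isSizeVector_of_card_add_card {x₁ x₀ y₁ y₀ z₁ z₀ : ℕ}
    (h : x₁ + y₁ + z₁ + ((x₁ + x₀) * (y₁ + y₀) + (x₁ + x₀) * (z₁ + z₀) +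
      (y₁ + y₀) * (z₁ + z₀)) = (x₁ + x₀) + (y₁ + y₀) + (z₁ + z₀) + 2)
    (hd : 1 ≤ x₁ + y₁ + z₁) (hp : 1 ≤ x₁ + x₀) (hrp : z₁ + z₀ ≤ x₁ + x₀)
    (hpq : x₁ + x₀ ≤ y₁ + y₀) (ht : x₁ + x₀ = 1 → z₁ + z₀ = 0 → y₀ ≤ 1) :
    IsSizeVector x₁ x₀ y₁ y₀ z₁ z₀ := by
  obtain ⟨p, hp'⟩ : ∃ p, p = x₁ + x₀ := ⟨_, rfl⟩
  obtain ⟨q, hq'⟩ : ∃ q, q = y₁ + y₀ := ⟨_, rfl⟩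
  obtain ⟨r, hr'⟩ : ∃ r, r = z₁ + z₀ := ⟨_, rfl⟩
  rw [← hp', ← hq', ← hr'] at h
  rw [← hp'] at hp hrp hpq ht
  rw [← hr'] at hrp ht
  rw [← hq'] at hpq
  have hp2 : p ≤ 2 := by
    by_contra! hlt
    nlinarith [Nat.mul_le_mul hlt hpq, Nat.zero_le (p * r), Nat.zero_le (q * r)]
  have hr1 : r ≤ 1 := by
    by_contra! hlt
    nlinarith [Nat.mul_le_mul hlt hrp, Nat.mul_le_mul (le_trans hlt hrp) hpq]
  have hd' : p * q + p * r + q * r + 1 ≤ p + q + r + 2 := by omega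
  -- For p = 1 and r = 0 the equation only says that `u` has three neighbours in the classes; it
  -- leaves q free, and `ht` supplies the bound 3 + 1.
  have hq4 : q ≤ 4 := by interval_cases p <;> interval_cases r <;> omega
  have hx₁ : x₁ ≤ p := by omega
  have hz₁ : z₁ ≤ r := by omega
  have hy₁ : y₁ ≤ q := by omega
  obtain rfl : x₀ = p - x₁ := by omega
  obtain rfl : y₀ = q - y₁ := by omega
  obtain rfl : z₀ = r - z₁ := by omega
  clear hp' hq' hr'
  unfold IsSizeVector
  interval_cases p <;> interval_cases r <;> interval_cases q <;>
    try (exfalso; omega)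
  all_goals
    interval_cases x₁ <;> interval_cases z₁ <;> interval_cases y₁ <;> first
      | (exfalso; omega)
      | simp

namespace IsPendantTripartition

variable {V : Type*} [DecidableEq V] {S : SimpleGraph V} {u v : V}

/-- There are more vectors than graphs because classes of equal size can be ordered in several ways:
`graph2` and `graph9` occur twice, `graph7` three times. -/
theorem isListed_of_isSizeVector {X₁ X₀ Y₁ Y₀ Z₁ Z₀ : Finset V}
    (h : IsPendantTripartition S u v (X₁ ∪ X₀) (Y₁ ∪ Y₀) (Z₁ ∪ Z₀))
    (hX₁ : ∀ w ∈ X₁, S.Adj u w) (hX₀ : ∀ w ∈ X₀, ¬ S.Adj u w)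
    (hY₁ : ∀ w ∈ Y₁, S.Adj u w) (hY₀ : ∀ w ∈ Y₀, ¬ S.Adj u w)
    (hZ₁ : ∀ w ∈ Z₁, S.Adj u w) (hZ₀ : ∀ w ∈ Z₀, ¬ S.Adj u w)
    (hc : IsSizeVector X₁.card X₀.card Y₁.card Y₀.card Z₁.card Z₀.card) : IsListed S := by
  rcases hc with ⟨h1, h2, h3, h4, h5, h6⟩ | ⟨h1, h2, h3, h4, h5, h6⟩ |
    ⟨h1, h2, h3, h4, h5, h6⟩ | ⟨h1, h2, h3, h4, h5, h6⟩ | ⟨h1, h2, h3, h4, h5, h6⟩ |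
    ⟨h1, h2, h3, h4, h5, h6⟩ | ⟨h1, h2, h3, h4, h5, h6⟩ | ⟨h1, h2, h3, h4, h5, h6⟩ |
    ⟨h1, h2, h3, h4, h5, h6⟩ | ⟨h1, h2, h3, h4, h5, h6⟩ | ⟨h1, h2, h3, h4, h5, h6⟩ |
    ⟨h1, h2, h3, h4, h5, h6⟩ | ⟨h1, h2, h3, h4, h5, h6⟩ | ⟨h1, h2, h3, h4, h5, h6⟩ |
    ⟨h1, h2, h3, h4, h5, h6⟩
  · obtain rfl := Finset.card_eq_zero.1 h1
    obtain ⟨a, rfl⟩ := Finset.card_eq_one.1 h2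
    obtain ⟨b, c, d, hbc, hbd, hcd, rfl⟩ := Finset.card_eq_three.1 h3
    obtain rfl := Finset.card_eq_zero.1 h4
    obtain rfl := Finset.card_eq_zero.1 h5
    obtain rfl := Finset.card_eq_zero.1 h6
    simp only [Finset.empty_union, Finset.union_empty] at h
    have iso : Nonempty (graph1 ≃g S) := by
      apply nonempty_iso_graph1 h <;> grind
    unfold IsListed; tauto
  · obtain ⟨a, b, hab, rfl⟩ := Finset.card_eq_two.1 h1
    obtain rfl := Finset.card_eq_zero.1 h2
    obtain rfl := Finset.card_eq_zero.1 h3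
    obtain ⟨c, d, hcd, rfl⟩ := Finset.card_eq_two.1 h4
    obtain rfl := Finset.card_eq_zero.1 h5
    obtain rfl := Finset.card_eq_zero.1 h6
    simp only [Finset.empty_union, Finset.union_empty] at h
    have iso : Nonempty (graph2 ≃g S) := by
      apply nonempty_iso_graph2 h <;> grind
    unfold IsListed; tauto
  · obtain rfl := Finset.card_eq_zero.1 h1
    obtain ⟨a, b, hab, rfl⟩ := Finset.card_eq_two.1 h2
    obtain ⟨c, d, hcd, rfl⟩ := Finset.card_eq_two.1 h3
    obtain rfl := Finset.card_eq_zero.1 h4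
    obtain rfl := Finset.card_eq_zero.1 h5
    obtain rfl := Finset.card_eq_zero.1 h6
    simp only [Finset.empty_union, Finset.union_empty] at h
    have iso : Nonempty (graph2 ≃g S) := by
      apply nonempty_iso_graph2 h.swap₁₂ <;> grind
    unfold IsListed; tauto
  · obtain rfl := Finset.card_eq_zero.1 h1
    obtain ⟨a, rfl⟩ := Finset.card_eq_one.1 h2
    obtain ⟨b, c, d, hbc, hbd, hcd, rfl⟩ := Finset.card_eq_three.1 h3
    obtain ⟨e, rfl⟩ := Finset.card_eq_one.1 h4
    obtain rfl := Finset.card_eq_zero.1 h5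
    obtain rfl := Finset.card_eq_zero.1 h6
    simp only [Finset.empty_union, Finset.singleton_union, Finset.insert_union] at h
    have iso : Nonempty (graph3 ≃g S) := by
      apply nonempty_iso_graph3 h <;> grind
    unfold IsListed; tauto
  · obtain ⟨a, rfl⟩ := Finset.card_eq_one.1 h1
    obtain ⟨b, rfl⟩ := Finset.card_eq_one.1 h2
    obtain rfl := Finset.card_eq_zero.1 h3
    obtain ⟨c, d, e, hcd, hce, hde, rfl⟩ := Finset.card_eq_three.1 h4
    obtain rfl := Finset.card_eq_zero.1 h5
    obtain rfl := Finset.card_eq_zero.1 h6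
    simp only [Finset.empty_union, Finset.singleton_union] at h
    have iso : Nonempty (graph4 ≃g S) := by
      apply nonempty_iso_graph4 h <;> grind
    unfold IsListed; tauto
  · obtain rfl := Finset.card_eq_zero.1 h1
    obtain ⟨a, b, hab, rfl⟩ := Finset.card_eq_two.1 h2
    obtain ⟨c, rfl⟩ := Finset.card_eq_one.1 h3
    obtain ⟨d, e, hde, rfl⟩ := Finset.card_eq_two.1 h4
    obtain rfl := Finset.card_eq_zero.1 h5
    obtain rfl := Finset.card_eq_zero.1 h6
    simp only [Finset.empty_union, Finset.singleton_union] at h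
    have iso : Nonempty (graph5 ≃g S) := by
      apply nonempty_iso_graph5 h <;> grind
    unfold IsListed; tauto
  · obtain ⟨a, rfl⟩ := Finset.card_eq_one.1 h1
    obtain rfl := Finset.card_eq_zero.1 h2
    obtain ⟨b, c, hbc, rfl⟩ := Finset.card_eq_two.1 h3
    obtain rfl := Finset.card_eq_zero.1 h4
    obtain rfl := Finset.card_eq_zero.1 h5
    obtain rfl := Finset.card_eq_zero.1 h6
    simp only [Finset.union_empty] at h
    have iso : Nonempty (graph6 ≃g S) := by
      apply nonempty_iso_graph6 h <;> grind
    unfold IsListed; tauto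
  · obtain ⟨a, rfl⟩ := Finset.card_eq_one.1 h1
    obtain rfl := Finset.card_eq_zero.1 h2
    obtain ⟨b, rfl⟩ := Finset.card_eq_one.1 h3
    obtain rfl := Finset.card_eq_zero.1 h4
    obtain rfl := Finset.card_eq_zero.1 h5
    obtain ⟨c, rfl⟩ := Finset.card_eq_one.1 h6
    simp only [Finset.empty_union, Finset.union_empty] at h
    have iso : Nonempty (graph7 ≃g S) := by
      apply nonempty_iso_graph7 h <;> grind
    unfold IsListed; tauto
  · obtain ⟨a, rfl⟩ := Finset.card_eq_one.1 h1
    obtain rfl := Finset.card_eq_zero.1 h2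
    obtain rfl := Finset.card_eq_zero.1 h3
    obtain ⟨b, rfl⟩ := Finset.card_eq_one.1 h4
    obtain ⟨c, rfl⟩ := Finset.card_eq_one.1 h5
    obtain rfl := Finset.card_eq_zero.1 h6
    simp only [Finset.empty_union, Finset.union_empty] at h
    have iso : Nonempty (graph7 ≃g S) := by
      apply nonempty_iso_graph7 h.swap₂₃ <;> grind
    unfold IsListed; tauto
  · obtain rfl := Finset.card_eq_zero.1 h1
    obtain ⟨a, rfl⟩ := Finset.card_eq_one.1 h2
    obtain ⟨b, rfl⟩ := Finset.card_eq_one.1 h3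
    obtain rfl := Finset.card_eq_zero.1 h4
    obtain ⟨c, rfl⟩ := Finset.card_eq_one.1 h5
    obtain rfl := Finset.card_eq_zero.1 h6
    simp only [Finset.empty_union, Finset.union_empty] at h
    have iso : Nonempty (graph7 ≃g S) := by
      apply nonempty_iso_graph7 h.swap₁₂.swap₂₃ <;> grind
    unfold IsListed; tauto
  · obtain ⟨a, rfl⟩ := Finset.card_eq_one.1 h1
    obtain rfl := Finset.card_eq_zero.1 h2
    obtain ⟨b, c, hbc, rfl⟩ := Finset.card_eq_two.1 h3
    obtain ⟨d, rfl⟩ := Finset.card_eq_one.1 h4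
    obtain rfl := Finset.card_eq_zero.1 h5
    obtain rfl := Finset.card_eq_zero.1 h6
    simp only [Finset.union_empty, Finset.singleton_union, Finset.insert_union] at h
    have iso : Nonempty (graph8 ≃g S) := by
      apply nonempty_iso_graph8 h <;> grind
    unfold IsListed; tauto
  · obtain ⟨a, rfl⟩ := Finset.card_eq_one.1 h1
    obtain rfl := Finset.card_eq_zero.1 h2
    obtain rfl := Finset.card_eq_zero.1 h3
    obtain ⟨b, c, hbc, rfl⟩ := Finset.card_eq_two.1 h4
    obtain rfl := Finset.card_eq_zero.1 h5
    obtain ⟨d, rfl⟩ := Finset.card_eq_one.1 h6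
    simp only [Finset.empty_union, Finset.union_empty] at h
    have iso : Nonempty (graph9 ≃g S) := by
      apply nonempty_iso_graph9 h.swap₂₃ <;> grind
    unfold IsListed; tauto
  · obtain rfl := Finset.card_eq_zero.1 h1
    obtain ⟨a, rfl⟩ := Finset.card_eq_one.1 h2
    obtain rfl := Finset.card_eq_zero.1 h3
    obtain ⟨b, c, hbc, rfl⟩ := Finset.card_eq_two.1 h4
    obtain ⟨d, rfl⟩ := Finset.card_eq_one.1 h5
    obtain rfl := Finset.card_eq_zero.1 h6
    simp only [Finset.empty_union, Finset.union_empty] at h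
    have iso : Nonempty (graph9 ≃g S) := by
      apply nonempty_iso_graph9 h.swap₁₂.swap₂₃.swap₁₂.swap₂₃ <;> grind
    unfold IsListed; tauto
  · obtain rfl := Finset.card_eq_zero.1 h1
    obtain ⟨a, rfl⟩ := Finset.card_eq_one.1 h2
    obtain ⟨b, rfl⟩ := Finset.card_eq_one.1 h3
    obtain ⟨c, rfl⟩ := Finset.card_eq_one.1 h4
    obtain rfl := Finset.card_eq_zero.1 h5
    obtain ⟨d, rfl⟩ := Finset.card_eq_one.1 h6
    simp only [Finset.empty_union, Finset.singleton_union] at h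
    have iso : Nonempty (graph10 ≃g S) := by
      apply nonempty_iso_graph10 h.swap₂₃ <;> grind
    unfold IsListed; tauto
  · obtain ⟨a, rfl⟩ := Finset.card_eq_one.1 h1
    obtain ⟨b, rfl⟩ := Finset.card_eq_one.1 h2
    obtain ⟨c, rfl⟩ := Finset.card_eq_one.1 h3
    obtain ⟨d, rfl⟩ := Finset.card_eq_one.1 h4
    obtain rfl := Finset.card_eq_zero.1 h5
    obtain rfl := Finset.card_eq_zero.1 h6
    simp only [Finset.union_empty, Finset.singleton_union] at h
    have iso : Nonempty (graph11 ≃g S) := by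
      apply nonempty_iso_graph11 h <;> grind
    unfold IsListed; tauto

end IsPendantTripartition

/-! ### From a multipartite rest to the list -/

section Classification

variable {V : Type*} [Fintype V] {S : SimpleGraph V} {u v : V} {X Y Z : Finset V}

omit [Fintype V] in
theorem isPendant_of_forall_adj_iff {a b : V} (h : ∀ w, S.Adj a w ↔ w = b) :
    IsPendant S a ∧ S.neighborSet a = {b} := by
  have : S.neighborSet a = {b} := by
    ext w
    simp [h w]
  exact ⟨by rw [IsPendant, this, Set.ncard_singleton], this⟩

omit [Fintype V] in
theorem eq_of_forall_adj_iff (ht : ¬ ∃ a b, IsPendantTwin S a b) {a a' b : V}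
    (h : ∀ w, S.Adj a w ↔ w = b) (h' : ∀ w, S.Adj a' w ↔ w = b) : a = a' := by
  by_contra hne
  obtain ⟨p, e⟩ := isPendant_of_forall_adj_iff h
  obtain ⟨p', e'⟩ := isPendant_of_forall_adj_iff h'
  exact ht ⟨a, a', hne, p, p', e.trans e'.symm⟩

theorem IsPendantTripartition.isListed_of_sorted (h : IsPendantTripartition S u v X Y Z)
    (hS : IsBicyclic S) (ht : ¬ ∃ a b, IsPendantTwin S a b) (hu : ∃ w, w ≠ v ∧ S.Adj u w)
    (hX : 1 ≤ X.card) (hZX : Z.card ≤ X.card) (hXY : X.card ≤ Y.card) : IsListed S := by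
  classical
  have hcount := h.card_add_card hS
  have split : ∀ A : Finset V,
      A = A.filter (S.Adj u) ∪ A.filter fun w => ¬ S.Adj u w := fun A =>
    (Finset.filter_union_filter_not_eq _ A).symm
  have cardA : ∀ A : Finset V,
      A.card = (A.filter (S.Adj u)).card + (A.filter fun w => ¬ S.Adj u w).card := fun A =>
    (Finset.card_filter_add_card_filter_not _).symm
  have h' := h
  rw [split X, split Y, split Z] at h'
  refine h'.isListed_of_isSizeVector (fun w hw => (Finset.mem_filter.1 hw).2)
    (fun w hw => (Finset.mem_filter.1 hw).2) (fun w hw => (Finset.mem_filter.1 hw).2)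
    (fun w hw => (Finset.mem_filter.1 hw).2) (fun w hw => (Finset.mem_filter.1 hw).2)
    (fun w hw => (Finset.mem_filter.1 hw).2) (isSizeVector_of_card_add_card ?_ ?_ ?_ ?_ ?_ ?_)
  · simpa only [← cardA] using hcount
  · obtain ⟨w, hw, huw⟩ := hu
    have pos : ∀ A : Finset V, w ∈ A → 0 < (A.filter (S.Adj u)).card := fun A hA =>
      Finset.card_pos.2 ⟨w, Finset.mem_filter.2 ⟨hA, huw⟩⟩
    rcases h.cover w with rfl | rfl | k | k | k
    · exact (S.loopless.irrefl _ huw).elim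
    · exact (hw rfl).elim
    all_goals have := pos _ k; omega
  · rwa [← cardA]
  · rwa [← cardA, ← cardA]
  · rwa [← cardA, ← cardA]
  · rw [← cardA, ← cardA]
    intro hX1 hZ0
    obtain ⟨c, rfl⟩ := Finset.card_eq_one.1 hX1
    obtain rfl := Finset.card_eq_zero.1 hZ0
    -- With `X = {c}` and `Z` empty, the non-neighbours of `u` in `Y` are pendants at `c`, so two of
    -- them would be twins.
    have leaf : ∀ a ∈ Y.filter fun w => ¬ S.Adj u w, ∀ w, S.Adj a w ↔ w = c := by
      intro a ha w
      rw [Finset.mem_filter] at ha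
      refine ⟨fun haw => ?_, ?_⟩
      · rcases h.cover w with rfl | rfl | k | k | k
        · exact (ha.2 haw.symm).elim
        · exact (h.notMem₂.1 ((h.adj_pendant a).1 haw.symm ▸ ha.1)).elim
        · exact Finset.mem_singleton.1 k
        · exact (h.indep₂ a ha.1 w k haw).elim
        · simp at k
      · rintro rfl
        exact (h.adj₁₂ w (Finset.mem_singleton_self w) a ha.1).symm
    exact Finset.card_le_one.2 fun a ha b hb => eq_of_forall_adj_iff ht (leaf a ha) (leaf b hb)

theorem IsPendantTripartition.isListed (h : IsPendantTripartition S u v X Y Z)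
    (hS : IsBicyclic S) (ht : ¬ ∃ a b, IsPendantTwin S a b) (hu : ∃ w, w ≠ v ∧ S.Adj u w)
    (hX : X.Nonempty) (hY : Y.Nonempty) : IsListed S := by
  have hp := Finset.card_pos.2 hX
  have hq := Finset.card_pos.2 hY
  rcases le_total X.card Y.card with hXY | hXY <;> rcases le_total X.card Z.card with hXZ | hXZ <;>
    rcases le_total Y.card Z.card with hYZ | hYZ
  · exact h.swap₁₂.swap₂₃.isListed_of_sorted hS ht hu (by omega) (by omega) (by omega)
  · exact h.swap₁₂.swap₂₃.swap₁₂.isListed_of_sorted hS ht hu (by omega) (by omega) (by omega)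
  · exact h.isListed_of_sorted hS ht hu (by omega) (by omega) (by omega)
  · exact h.isListed_of_sorted hS ht hu (by omega) (by omega) (by omega)
  · exact h.swap₂₃.isListed_of_sorted hS ht hu (by omega) (by omega) (by omega)
  · exact h.swap₂₃.isListed_of_sorted hS ht hu (by omega) (by omega) (by omega)
  · exact h.swap₂₃.swap₁₂.isListed_of_sorted hS ht hu (by omega) (by omega) (by omega)
  · exact h.swap₁₂.isListed_of_sorted hS ht hu (by omega) (by omega) (by omega)

end Classification

/-! ### Necessity, and the equivalence -/

namespace WeightedGraph

variable {V : Type*} [Fintype V] {G : WeightedGraph V}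

theorem isListed_of_posIndex_eq_two (hS : IsBicyclic G.graph) (hp : ∃ v, IsPendant G.graph v)
    (ht : ¬ ∃ a b, IsPendantTwin G.graph a b) (hG : G.posIndex = 2) : IsListed G.graph := by
  obtain ⟨v, hv⟩ := hp
  obtain ⟨u, hvu⟩ := Set.ncard_eq_one.1 hv
  have hv : ∀ w, G.graph.Adj v w ↔ w = u := fun w => by
    rw [← SimpleGraph.mem_neighborSet, hvu, Set.mem_singleton_iff]
  have huv : G.graph.Adj v u := (hv u).2 rfl
  -- On two vertices a bicyclic graph would need three edges.
  have hsub : ∃ w, w ≠ u ∧ w ≠ v := by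
    classical
    by_contra! hall
    have hcard : Fintype.card V = 2 := by
      have huniv : (Finset.univ : Finset V) = {u, v} := by
        ext w
        have := hall w
        simp only [Finset.mem_univ, Finset.mem_insert, Finset.mem_singleton, true_iff]
        tauto
      rw [← Finset.card_univ, huniv, Finset.card_pair huv.ne']
    have hle : G.graph.edgeFinset.card ≤ (Fintype.card V).choose 2 :=
      G.graph.card_edgeFinset_le_card_choose_two
    have hE : G.graph.edgeSet.ncard = G.graph.edgeFinset.card := by
      rw [← SimpleGraph.coe_edgeFinset, Set.ncard_coe_finset]
    rw [← hE, hS.2, hcard] at hle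
    norm_num at hle
  obtain ⟨w₀, hw₀u, hw₀v⟩ := hsub
  have hu : ∃ w, w ≠ v ∧ G.graph.Adj u w := by
    obtain ⟨p⟩ := hS.1.preconnected u w₀
    obtain ⟨d, -, hd, hd'⟩ := p.exists_boundary_dart {u, v} (by simp) (by simp [*])
    simp only [Set.mem_insert_iff, Set.mem_singleton_iff, not_or] at hd hd'
    have hadj := d.adj
    rcases hd with h | h
    · rw [h] at hadj
      exact ⟨_, hd'.2, hadj⟩
    · rw [h] at hadj
      exact (hd'.1 ((hv _).1 hadj)).elim
  -- A vertex with no neighbour besides `u` would be a pendant twin of `v`.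
  have hiso : ∀ z, z ≠ u → z ≠ v → ∃ z', z' ≠ u ∧ G.graph.Adj z z' := by
    intro z hzu hzv
    by_contra! hall
    have hz : ∀ w, G.graph.Adj z w ↔ w = u := by
      have himp : ∀ w, G.graph.Adj z w → w = u := fun w hw => by
        by_contra hne
        exact hall w hne hw
      refine fun w => ⟨himp w, ?_⟩
      rintro rfl
      obtain ⟨p⟩ := hS.1.preconnected z w
      cases p with
      | nil => exact (hzu rfl).elim
      | cons h _ => exact himp _ h ▸ h
    exact hzv (eq_of_forall_adj_iff ht hz hv)
  have htrans : ∀ a b c, a ≠ u → b ≠ u → c ≠ u → c ≠ v → G.graph.Adj a b →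
      G.graph.Adj c a ∨ G.graph.Adj c b := by
    intro a b c ha hb hc hcv hab
    by_contra! hn
    obtain ⟨c', hc'u, hcc'⟩ := hiso c hc hcv
    have nv : ∀ w, w ≠ u → ¬ G.graph.Adj v w := fun w hw k => hw ((hv w).1 k)
    have := G.three_le_posIndex huv hcc' hab (nv c hc) (nv a ha) hn.1 (nv c' hc'u) (nv b hb) hn.2
    omega
  obtain ⟨y, hyu, hxy⟩ := hiso w₀ hw₀u hw₀v
  obtain ⟨X, Y, Z, h, hX, hY⟩ := exists_isPendantTripartition hS hv hw₀u hyu hxy hu htrans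
  exact h.isListed hS ht hu hX hY

/-- This transports the vanishing minors to labels, with all combinatorial hypotheses in one
conjunction that `decide` settles on a concrete graph. -/
theorem labelWeight_mul_eq {n : ℕ} {H : SimpleGraph (Fin n)} (hG : G.posIndex = 2)
    (φ : H ≃g G.graph) (a b c c' d d' : Fin n)
    (h : H.Adj a b ∧ (∀ x, H.Adj a x → x = b) ∧ c ≠ b ∧ c' ≠ b ∧ d ≠ b ∧ d' ≠ b ∧
      ¬ H.Adj c c' ∧ H.Adj c d ∧ H.Adj c' d' ∧ H.Adj c d' ∧ H.Adj c' d) :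
    G.labelWeight φ c d * G.labelWeight φ c' d' =
      G.labelWeight φ c d' * G.labelWeight φ c' d := by
  obtain ⟨hab, ha, hc, hc', hd, hd', hcc', h1, h2, h3, h4⟩ := h
  rw [labelWeight_eq_adjMatrix G φ h1, labelWeight_eq_adjMatrix G φ h2,
    labelWeight_eq_adjMatrix G φ h3, labelWeight_eq_adjMatrix G φ h4]
  refine G.adjMatrix_mul_eq_of_posIndex_eq_two hG (φ.map_adj_iff.2 hab) (fun x hx => ?_)
    (φ.injective.ne hc) (φ.injective.ne hc') (φ.injective.ne hd) (φ.injective.ne hd')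
    (fun k => hcc' (φ.map_adj_iff.1 k))
  obtain ⟨i, rfl⟩ := φ.surjective x
  rw [ha i (φ.map_adj_iff.1 hx)]

theorem posIndex_eq_two_iff (hS : IsBicyclic G.graph) (hp : ∃ v, IsPendant G.graph v)
    (ht : ¬ ∃ a b, IsPendantTwin G.graph a b) :
    G.posIndex = 2 ↔
      G.IsType1 ∨ G.IsType2 ∨ G.IsType3 ∨ G.IsType4 ∨ G.IsType5 ∨ G.IsType6 ∨
      G.IsType7 ∨ G.IsType8 ∨ G.IsType9 ∨ G.IsType10 ∨ G.IsType11 := by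
  constructor
  · intro hG
    rcases isListed_of_posIndex_eq_two hS hp ht hG with
      h | ⟨⟨φ⟩⟩ | h | ⟨⟨φ⟩⟩ | ⟨⟨φ⟩⟩ | h | h | h | ⟨⟨φ⟩⟩ | ⟨⟨φ⟩⟩ | ⟨⟨φ⟩⟩
    · exact .inl h
    · refine .inr <| .inl ⟨φ, ?_⟩
      rw [G.labelWeight_comm φ 3 1, G.labelWeight_comm φ 2 1, mul_comm (G.labelWeight φ 1 2)]
      exact labelWeight_mul_eq hG φ 5 4 0 1 2 3 (by decide)
    · exact .inr <| .inr <| .inl h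
    · refine .inr <| .inr <| .inr <| .inl ⟨φ, ?_⟩
      rw [G.labelWeight_comm φ 3 1, G.labelWeight_comm φ 2 1, G.labelWeight_comm φ 4 1,
        mul_comm (G.labelWeight φ 1 2), mul_comm (G.labelWeight φ 1 2)]
      exact ⟨labelWeight_mul_eq hG φ 6 5 0 1 2 3 (by decide),
        labelWeight_mul_eq hG φ 6 5 0 1 2 4 (by decide)⟩
    · refine .inr <| .inr <| .inr <| .inr <| .inl ⟨φ, ?_⟩
      rw [G.labelWeight_comm φ 3 1, G.labelWeight_comm φ 2 1, G.labelWeight_comm φ 4 1,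
        mul_comm (G.labelWeight φ 1 2), mul_comm (G.labelWeight φ 1 2)]
      exact ⟨labelWeight_mul_eq hG φ 6 5 0 1 2 3 (by decide),
        labelWeight_mul_eq hG φ 6 5 0 1 2 4 (by decide)⟩
    · exact .inr <| .inr <| .inr <| .inr <| .inr <| .inl h
    · exact .inr <| .inr <| .inr <| .inr <| .inr <| .inr <| .inl h
    · exact .inr <| .inr <| .inr <| .inr <| .inr <| .inr <| .inr <| .inl h
    · refine .inr <| .inr <| .inr <| .inr <| .inr <| .inr <| .inr <| .inr <| .inl ⟨φ, ?_⟩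
      -- Vertices 0 and 1 are adjacent here, so the independent rows must be 2 and 3.
      rw [G.labelWeight_comm φ 0 2, G.labelWeight_comm φ 0 3]
      exact labelWeight_mul_eq hG φ 5 4 2 3 0 1 (by decide)
    · refine .inr <| .inr <| .inr <| .inr <| .inr <| .inr <| .inr <| .inr <| .inr <| .inl ⟨φ, ?_⟩
      rw [G.labelWeight_comm φ 0 2, G.labelWeight_comm φ 0 3]
      exact labelWeight_mul_eq hG φ 5 4 2 3 0 1 (by decide)
    · refine .inr <| .inr <| .inr <| .inr <| .inr <| .inr <| .inr <| .inr <| .inr <| .inr ⟨φ, ?_⟩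
      rw [G.labelWeight_comm φ 2 3, mul_comm (G.labelWeight φ 3 2)]
      exact labelWeight_mul_eq hG φ 5 4 0 3 2 1 (by decide)
  · rintro (h | h | h | h | h | h | h | h | h | h | h)
    all_goals exact h.posIndex_eq_two

end WeightedGraph

end InertiaBicyclic

open InertiaBicyclic in
theorem theorem4p4 {V : Type*} [Fintype V] (G : WeightedGraph V) :
    (IsBicyclic G.graph →
      (∃ v, IsPendant G.graph v) →
      (¬ ∃ u v, IsPendantTwin G.graph u v) →
      (G.posIndex = 2 ↔
        G.IsType1 ∨ G.IsType2 ∨ G.IsType3 ∨ G.IsType4 ∨ G.IsType5 ∨ G.IsType6 ∨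
        G.IsType7 ∨ G.IsType8 ∨ G.IsType9 ∨ G.IsType10 ∨ G.IsType11)) ∧
    (∀ H ∈ furtherGraphs, Nonempty (graphOn H.1 H.2 ≃g G.graph) → 3 ≤ G.posIndex) :=
  ⟨WeightedGraph.posIndex_eq_two_iff, fun H hH ⟨φ⟩ =>
    (WeightedGraph.hasThreeEdges_of_mem_furtherGraphs H hH).three_le_posIndex G φ⟩
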